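/- **Notation.** For two probability measures $\mu,\nu$ on the same space, $H(\mu|\nu)=\int h\log h\,d\nu\in[0,+\infty]$ with $h=d\mu/d\nu$ if $\mu\ll\nu$, and $H(\mu|\nu)=+\infty$ otherwise. For $N\ge1$ let $S^{N-1}(\sqrt N)\subset\mathbb R^N$ be the sphere of radius $\sqrt N$ centred at $0$ and $\sigma^N$ the uniform probability measure on it. A probability measure on $S^{N-1}(\sqrt N)$ is symmetric if it is invariant under all permutations of the coordinates $v_1,\dots,v_N$; $P_k m$ denotes the marginal on $\mathbb R^k$ of $m$ in the first $k$ coordinates ($k\le N$). Given a probability density $g$ on $\mathbb R$ and $\nu(dv)=g(v)\,dv$, put $$Z_N(g,\sqrt N)=\int_{S^{N-1}(\sqrt N)}\prod_{j=1}^N g(v_j)\,d\sigma^N(v),\qquad [\nu^{\otimes N}]_{S^{N-1}(\sqrt N)}=\frac{\prod_{j=1}^N g(v_j)}{Z_N(g,\sqrt N)}\,\sigma^N .$$ Weak convergence means convergence against bounded continuous functions. Let $\gamma$ be the standard Gaussian measure on $\mathbb R$. **Theorem.** (a) Let $g$ be a probability density on $\mathbb R$ with $$\int g(x)x^2\,dx=1,\qquad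 \int g(x)x^4\,dx<+\infty,\qquad g\in L^p(\mathbb R)\ \text{ for some } p>1,$$ and let $\nu(dv)=g(v)\,dv$. Then $0<Z_N(g,\sqrt N)<+\infty$ for all sufficiently large $N$, so that $[\nu^{\otimes N}]_{S^{N-1}(\sqrt N)}$ is a well-defined probability measure. For each positive integer $N$ let $\mu^{(N)}$ be a symmetric probability measure on $S^{N-1}(\sqrt N)$. If $P_1\mu^{(N)}\to\mu$ weakly as $N\to\infty$ for a probability measure $\mu$ on $\mathbb R$, then $$H(\mu|\nu)\le\liminf_{N\to\infty}\frac{H\bigl(\mu^{(N)}\,\big|\,[\nu^{\otimes N}]_{S^{N-1}(\sqrt N)}\bigr)}{N}.$$ More generally, if for some positive integer $k$, $P_k\mu^{(N)}\to\mu_k$ weakly as $N\to\infty$ for a probability measure $\mu_k$ on $\mathbb R^k$, then $$\frac{H(\mu_k|\nu^{\otimes k})}{k}\le\liminf_{N\to\infty}\frac{H\bigl(\mu^{(N)}\,\big|\,[\nu^{\otimes N}]_{S^{N-1}(\sqrt N)}\bigr)}{N}.$$ (b) Let $\mu$ be a probability measure on $\mathbb R$ and let $(\mu^{(N)})_{N\ge1}$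 be $\mu$-chaotic, i.e. each $\mu^{(N)}$ is a symmetric probability measure on $S^{N-1}(\sqrt N)$ and, for every positive integer $k$, $P_k\mu^{(N)}\to\mu^{\otimes k}$ weakly as $N\to\infty$. Then $$H(\mu|\gamma)\le\liminf_{N\to\infty}\frac{H(\mu^{(N)}|\sigma^N)}{N}.$$ -/

import Mathlib

open MeasureTheory Filter Topology ProbabilityTheory InformationTheory
open scoped ENNReal

namespace KacChaos

/-- The sphere `S^{N-1}(√N)` in the Euclidean space `ℝ^N`. -/
abbrev KacSphere (N : ℕ) : Type :=
  Metric.sphere (0 : EuclideanSpace ℝ (Fin N)) (Real.sqrt N)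

/-- The dilation of the unit sphere of `ℝ^N` onto the sphere of radius `√N`. -/
noncomputable def dilate (N : ℕ) (x : Metric.sphere (0 : EuclideanSpace ℝ (Fin N)) 1) :
    KacSphere N :=
  ⟨Real.sqrt N • (x : EuclideanSpace ℝ (Fin N)), by
    simp [norm_smul, abs_of_nonneg (Real.sqrt_nonneg _)]⟩

/-- The uniform probability measure `σ^N` on `S^{N-1}(√N)`, for `N ≥ 1`: the image under dilation
of the normalized surface measure of the unit sphere. -/
noncomputable def unif (N : ℕ) : Measure (KacSphere N) :=
  ((volume : Measure (EuclideanSpace ℝ (Fin N))).toSphere Set.univ)⁻¹ •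
    (volume : Measure (EuclideanSpace ℝ (Fin N))).toSphere.map (dilate N)

/-- The function `(v_1, …, v_N) ↦ ∏_j g(v_j)` on `S^{N-1}(√N)`. -/
noncomputable def tensorDensity (g : ℝ → ℝ) (N : ℕ) (v : KacSphere N) : ℝ≥0∞ :=
  ∏ j : Fin N, ENNReal.ofReal (g ((v : EuclideanSpace ℝ (Fin N)) j))

/-- The normalizing constant `Z_N(g, √N) = ∫ ∏_j g(v_j) dσ^N(v)`. -/
noncomputable def Z (g : ℝ → ℝ) (N : ℕ) : ℝ≥0∞ :=
  ∫⁻ v, tensorDensity g N v ∂(unif N)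

/-- The conditioned tensor product `[ν^{⊗N}]_{S^{N-1}(√N)}` for `ν(dv) = g(v) dv`: the measure with
density `Z_N(g, √N)⁻¹ ∏_j g(v_j)` with respect to `σ^N`. -/
noncomputable def condTensor (g : ℝ → ℝ) (N : ℕ) : Measure (KacSphere N) :=
  (Z g N)⁻¹ • (unif N).withDensity (tensorDensity g N)

/-- The measure `ν(dv) = g(v) dv` on `ℝ`. -/
noncomputable def densityMeasure (g : ℝ → ℝ) : Measure ℝ :=
  volume.withDensity fun v => ENNReal.ofReal (g v)

/-- The action of a permutation of the coordinates on `S^{N-1}(√N)`. -/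
noncomputable def permute {N : ℕ} (τ : Equiv.Perm (Fin N)) (v : KacSphere N) : KacSphere N :=
  ⟨WithLp.toLp 2 fun i => (v : EuclideanSpace ℝ (Fin N)) (τ i), by
    have h := v.2
    rw [mem_sphere_zero_iff_norm, EuclideanSpace.norm_eq] at h ⊢
    refine Eq.trans ?_ h
    exact congrArg _ (Equiv.sum_comp τ fun i => ‖(v : EuclideanSpace ℝ (Fin N)) i‖ ^ 2)⟩

/-- Symmetry of a probability measure on `S^{N-1}(√N)` under permutations of `v_1, …, v_N`. -/
def IsSymmetric {N : ℕ} (m : ProbabilityMeasure (KacSphere N)) : Prop :=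
  ∀ τ : Equiv.Perm (Fin N),
    (m : Measure (KacSphere N)).map (permute τ) = (m : Measure (KacSphere N))

/-- The first `k` coordinates `(v_1, …, v_k)` of a point of `S^{N-1}(√N)`. When `k > N` (a case
that concerns only finitely many `N`) the missing coordinates are set to `0`. -/
noncomputable def firstCoords (k N : ℕ) (v : KacSphere N) : Fin k → ℝ :=
  fun i => if h : (i : ℕ) < N then (v : EuclideanSpace ℝ (Fin N)) ⟨i, h⟩ else 0

theorem measurable_firstCoords (k N : ℕ) : Measurable (firstCoords k N) := by
  refine measurable_pi_lambda _ fun i => ?_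
  unfold firstCoords
  split_ifs with h
  · fun_prop
  · fun_prop

/-- The marginal `P_k m` of `m` on the first `k` coordinates, a probability measure on `ℝ^k`. -/
noncomputable def marginal (k : ℕ) {N : ℕ} (m : ProbabilityMeasure (KacSphere N)) :
    ProbabilityMeasure (Fin k → ℝ) :=
  m.map (measurable_firstCoords k N).aemeasurable

/-- The first marginal `P_1 m`, as a probability measure on `ℝ`. -/
noncomputable def marginalOne {N : ℕ} (m : ProbabilityMeasure (KacSphere N)) :
    ProbabilityMeasure ℝ :=
  (marginal 1 m).map (measurable_pi_apply (0 : Fin 1)).aemeasurable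

/-- The tensor power `μ^{⊗k}`, a probability measure on `ℝ^k`. -/
noncomputable def tensorPower (μ : ProbabilityMeasure ℝ) (k : ℕ) :
    ProbabilityMeasure (Fin k → ℝ) :=
  ⟨Measure.pi fun _ => (μ : Measure ℝ), inferInstance⟩

/-- `μ`-chaoticity of a sequence of probability measures on the spheres `S^{N-1}(√N)`. -/
def IsChaotic (μ : ProbabilityMeasure ℝ) (m : ∀ N : ℕ, ProbabilityMeasure (KacSphere N)) : Prop :=
  (∀ N, 0 < N → IsSymmetric (m N)) ∧
    ∀ k : ℕ, 0 < k → Tendsto (fun N => marginal k (m N)) atTop (𝓝 (tensorPower μ k))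

end KacChaos

/-! By Donsker–Varadhan, H(m|π) is the supremum over bounded f of ∫ f dm − log ∫ e^f dπ. The test
function on the sphere is Φ(v) = Σ ψ(block), summed over about N/k disjoint blocks of k coordinates,
where ψ = φ − log ∫ e^φ dν^{⊗k}, so that ∫ e^ψ dν^{⊗k} = 1. By symmetry ∫ Φ dμ^(N) is the number of
blocks times ∫ ψ dP_kμ^(N). If log ∫ e^Φ d[ν^{⊗N}] is at most o(N), dividing by N and letting N → ∞
bounds the liminf below by (∫ φ dμ_k − log ∫ e^φ dν^{⊗k})/k, and the supremum over bounded
continuous φ is H(μ_k|ν^{⊗k})/k.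

It remains to show ∫ ∏g(v_j) e^Φ dσ^N ≤ e^{o(N)} Z_N. With N = n + 1, projecting out v_i turns |v_i|
dσ^N into a constant c_n times Lebesgue measure on a ball (`unif_slice`). Both sides are compared
with the same c_n, whose value is never needed.

Upper bound (`exists_lintegral_tensorDensity_mul_le`): removing v_i costs a factor g(v_i)/|v_i|,
which need not be bounded. A fixed number m of coordinates is therefore kept out of the blocks, and
the product of their densities is at most a sum over i of |t_i| times a product over j ≠ i of
g(t_j)^q |t_j|^{1−q}, q = m/(m−1). These weights are integrable for q near 1 because g is in L^p;
each block contributes 1. The result is c_n K with K independent of N.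

Lower bound (`eventually_le_iterate_lconvolution`): Z_N ≥ c_n h^{*(n+1)}(n+1), where h is the
density of v². A subexponential bound suffices, so no local limit theorem is used. Some convolution
power of h is bounded below near its mean. About ηn factors then give a density at least e^{−Aηn} on
an interval of length of order n, and by Chebyshev (fourth moment) the energy of the other particles
puts the remainder in that interval with probability at least 1/2. Small η makes the loss at most
e^{−εn}.

Part (b) is the case of Gaussian g, whose tensor power is constant on the sphere. -/

namespace KacChaos

/-! ### The Donsker–Varadhan variational formula -/

section Entropy

variable {α : Type*} [MeasurableSpace α]

theorem integrable_of_bounded {μ : Measure α} [IsFiniteMeasure μ] {f : α → ℝ} (hf : Measurable f)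
    {C : ℝ} (hC : ∀ x, |f x| ≤ C) : Integrable f μ :=
  Integrable.of_bound hf.aestronglyMeasurable C (Eventually.of_forall hC)

theorem integrable_exp_of_bounded {μ : Measure α} [IsFiniteMeasure μ] {f : α → ℝ}
    (hf : Measurable f) {C : ℝ} (hC : ∀ x, |f x| ≤ C) : Integrable (fun x => Real.exp (f x)) μ :=
  integrable_of_bounded (C := Real.exp C) (Real.measurable_exp.comp hf) fun x => by
    rw [abs_of_pos (Real.exp_pos _)]
    exact Real.exp_le_exp.2 ((le_abs_self _).trans (hC x))

/-- The easy half of the Donsker–Varadhan variational principle. -/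
theorem ofReal_sub_log_le_klDiv (μ ν : Measure α) [IsProbabilityMeasure μ]
    [IsProbabilityMeasure ν] {f : α → ℝ} (hf : Measurable f) {C : ℝ} (hC : ∀ x, |f x| ≤ C) :
    ENNReal.ofReal (∫ x, f x ∂μ - Real.log (∫ x, Real.exp (f x) ∂ν)) ≤ klDiv μ ν := by
  by_cases h : μ ≪ ν ∧ Integrable (llr μ ν) μ
  swap
  · rw [klDiv_eq_top_iff.2 fun h1 h2 => h ⟨h1, h2⟩]
    exact le_top
  obtain ⟨hac, hint⟩ := h
  have hexp := integrable_exp_of_bounded (μ := ν) hf hC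
  have hfμ := integrable_of_bounded (μ := μ) hf hC
  -- Nonnegativity of the entropy of μ relative to the tilted measure e^f ν / ∫ e^f dν, expanded, is
  -- the inequality.
  have := isProbabilityMeasure_tilted hexp
  have h1 := integral_llr_add_sub_measure_univ_nonneg
    (hac.trans (absolutelyContinuous_tilted hexp))
    (integrable_llr_tilted_right hac hfμ hint hexp)
  rw [integral_llr_tilted_right hac hfμ hexp hint] at h1
  rw [klDiv_of_ac_of_integrable hac hint]
  refine ENNReal.ofReal_le_ofReal ?_
  simp only [probReal_univ] at h1 ⊢
  linarith

/-- Clipping to `[-C, C]`. -/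
def clip (C x : ℝ) : ℝ := max (-C) (min x C)

theorem continuous_clip (C : ℝ) : Continuous (clip C) := by
  unfold clip
  fun_prop

theorem abs_clip_le {C : ℝ} (hC : 0 ≤ C) (x : ℝ) : |clip C x| ≤ C := by
  unfold clip
  rw [abs_le]
  exact ⟨le_max_left _ _, max_le (by linarith) (min_le_right _ _)⟩

theorem clip_of_abs_le {C x : ℝ} (h : |x| ≤ C) : clip C x = x := by
  unfold clip
  rw [abs_le] at h
  rw [min_eq_left h.2, max_eq_right h.1]

/-- Approximation in L¹ followed by an a.e. convergent subsequence; clipping at C keeps the uniform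
bound needed for dominated convergence without moving the limit. -/
theorem exists_boundedContinuous_tendsto_ae [TopologicalSpace α] [NormalSpace α] [BorelSpace α]
    (μ : Measure α) [IsFiniteMeasure μ] [μ.WeaklyRegular] {f : α → ℝ} (hf : Measurable f)
    {C : ℝ} (hC0 : 0 ≤ C) (hC : ∀ x, |f x| ≤ C) :
    ∃ φ : ℕ → BoundedContinuousFunction α ℝ, (∀ n x, |φ n x| ≤ C) ∧
      ∀ᵐ x ∂μ, Tendsto (fun n => φ n x) atTop (𝓝 (f x)) := by
  have hmem : MemLp f 1 μ := memLp_one_iff_integrable.2 (integrable_of_bounded hf hC)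
  have key : ∀ n : ℕ, ∃ u : BoundedContinuousFunction α ℝ,
      eLpNorm (f - ⇑u) 1 μ ≤ ((n : ℝ≥0∞) + 1)⁻¹ := fun n => by
    obtain ⟨u, hu, -⟩ := hmem.exists_boundedContinuous_eLpNorm_sub_le ENNReal.one_ne_top
      (ε := ((n : ℝ≥0∞) + 1)⁻¹) (by simp)
    exact ⟨u, hu⟩
  choose u hu using key
  have hlim : Tendsto (fun n => eLpNorm (⇑(u n) - f) 1 μ) atTop (𝓝 0) := by
    refine tendsto_of_tendsto_of_tendsto_of_le_of_le tendsto_const_nhds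
      (h := fun n : ℕ => ((n : ℝ≥0∞) + 1)⁻¹) ?_ (fun _ => bot_le) fun n => ?_
    · have := (ENNReal.tendsto_inv_nat_nhds_zero.comp (tendsto_add_atTop_nat 1))
      refine this.congr fun n => ?_
      simp
    · rw [eLpNorm_sub_comm]
      exact hu n
  have hm := tendstoInMeasure_of_tendsto_eLpNorm one_ne_zero
    (fun n => (u n).continuous.measurable.aestronglyMeasurable) hf.aestronglyMeasurable hlim
  obtain ⟨ns, -, hns⟩ := hm.exists_seq_tendsto_ae
  refine ⟨fun n => BoundedContinuousFunction.ofNormedAddCommGroup (fun x => clip C (u (ns n) x))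
    ((continuous_clip C).comp (u (ns n)).continuous) C fun x => abs_clip_le hC0 _,
    fun n x => abs_clip_le hC0 _, ?_⟩
  filter_upwards [hns] with x hx
  have := ((continuous_clip C).tendsto _).comp hx
  rw [clip_of_abs_le (hC x)] at this
  exact this

/-- A Donsker–Varadhan bound over bounded continuous functions extends to bounded measurable
functions. -/
theorem sub_log_le_of_forall_boundedContinuous [TopologicalSpace α] [NormalSpace α] [BorelSpace α]
    (μ ν : Measure α) [IsProbabilityMeasure μ] [IsProbabilityMeasure ν] [(μ + ν).WeaklyRegular]
    {L : ℝ} (h : ∀ φ : BoundedContinuousFunction α ℝ,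
      ∫ x, φ x ∂μ - Real.log (∫ x, Real.exp (φ x) ∂ν) ≤ L)
    {f : α → ℝ} (hf : Measurable f) {C : ℝ} (hC0 : 0 ≤ C) (hC : ∀ x, |f x| ≤ C) :
    ∫ x, f x ∂μ - Real.log (∫ x, Real.exp (f x) ∂ν) ≤ L := by
  -- Approximating with respect to μ + ν gives one sequence that converges a.e. for both measures.
  obtain ⟨φ, hφ, hlim⟩ := exists_boundedContinuous_tendsto_ae (μ + ν) hf hC0 hC
  rw [ae_add_measure_iff] at hlim
  have h1 : Tendsto (fun n => ∫ x, φ n x ∂μ) atTop (𝓝 (∫ x, f x ∂μ)) :=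
    tendsto_integral_of_dominated_convergence (fun _ => C)
      (fun n => (φ n).continuous.measurable.aestronglyMeasurable) (integrable_const _)
      (fun n => Eventually.of_forall fun x => hφ n x) hlim.1
  have h2 : Tendsto (fun n => ∫ x, Real.exp (φ n x) ∂ν) atTop (𝓝 (∫ x, Real.exp (f x) ∂ν)) := by
    refine tendsto_integral_of_dominated_convergence (fun _ => Real.exp C)
      (fun n => (Real.measurable_exp.comp (φ n).continuous.measurable).aestronglyMeasurable)
      (integrable_const _) (fun n => Eventually.of_forall fun x => ?_) ?_
    · rw [Real.norm_eq_abs, abs_of_pos (Real.exp_pos _)]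
      exact Real.exp_le_exp.2 ((le_abs_self _).trans (hφ n x))
    · filter_upwards [hlim.2] with x hx
      exact (Real.continuous_exp.tendsto _).comp hx
  have hpos : 0 < ∫ x, Real.exp (f x) ∂ν := integral_exp_pos (integrable_exp_of_bounded hf hC)
  exact le_of_tendsto (h1.sub (h2.log hpos.ne')) (Eventually.of_forall fun n => h (φ n))

/-- The clipped value c lies between 0 and log x, so c (x − e^c) ≥ 0, while e^c − 1 ≤ c e^c by
convexity. This gives the sign needed for Fatou's lemma below. -/
theorem exp_sub_one_le_mul_clip_log {C x : ℝ} (hC : 0 ≤ C) (hx : 0 < x) :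
    Real.exp (clip C (Real.log x)) - 1 ≤ x * clip C (Real.log x) := by
  set c := clip C (Real.log x) with hc
  have h1 : c * Real.exp c ≤ x * c := by
    rcases le_total 0 (Real.log x) with h | h
    · have h0 : 0 ≤ c := le_max_of_le_right (le_min h hC)
      have h2 : c ≤ Real.log x := max_le (by linarith) (min_le_left _ _)
      have := Real.exp_le_exp.2 h2
      rw [Real.exp_log hx] at this
      nlinarith
    · have h0 : c ≤ 0 := max_le (by linarith) (min_le_of_left_le h)
      have h2 : Real.log x ≤ c := le_max_of_le_right (le_min le_rfl (h.trans hC))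
      have := Real.exp_le_exp.2 h2
      rw [Real.exp_log hx] at this
      nlinarith
  have h2 := Real.add_one_le_exp (-c)
  have h3 : Real.exp (-c) * Real.exp c = 1 := by rw [← Real.exp_add]; simp
  nlinarith [Real.exp_pos c]

/-- The hard half of the Donsker–Varadhan variational principle, over bounded measurable
functions. -/
theorem klDiv_le_of_forall_bounded (μ ν : Measure α) [IsProbabilityMeasure μ]
    [IsProbabilityMeasure ν] {L : ℝ}
    (h : ∀ (f : α → ℝ) (C : ℝ), Measurable f → 0 ≤ C → (∀ x, |f x| ≤ C) →
      ∫ x, f x ∂μ - Real.log (∫ x, Real.exp (f x) ∂ν) ≤ L) :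
    klDiv μ ν ≤ ENNReal.ofReal L := by
  have hac : μ ≪ ν := by
    refine Measure.AbsolutelyContinuous.mk fun s hs hνs => ?_
    by_contra hne
    have hpos : 0 < μ.real s := by
      rw [measureReal_def]
      exact ENNReal.toReal_pos hne (measure_ne_top _ _)
    -- On a ν-null set s the test function t·1_s has exponential integral 1, so the bound is linear
    -- in t and forces μ(s) = 0.
    have hb : ∀ t : ℝ, 0 ≤ t → t * μ.real s ≤ L := fun t ht => by
      have h1 := h (s.indicator fun _ => t) t (measurable_const.indicator hs) ht fun x => by
        by_cases hx : x ∈ s <;> simp [hx, abs_of_nonneg ht, ht]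
      have h2 : ∫ x, Real.exp (s.indicator (fun _ => t) x) ∂ν = 1 := by
        have : (fun x => Real.exp (s.indicator (fun _ => t) x)) =ᵐ[ν] fun _ => 1 := by
          filter_upwards [measure_eq_zero_iff_ae_notMem.1 hνs] with x hx
          simp [hx]
        rw [integral_congr_ae this]
        simp
      rw [h2, Real.log_one, integral_indicator hs] at h1
      simpa [mul_comm] using h1
    have h3 := hb ((|L| + 1) / μ.real s) (by positivity)
    rw [div_mul_cancel₀ _ hpos.ne'] at h3
    linarith [le_abs_self L]
  set r : α → ℝ := fun x => (μ.rnDeriv ν x).toReal with hr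
  have hrm : Measurable r := (Measure.measurable_rnDeriv μ ν).ennreal_toReal
  have hr0 : ∀ x, 0 ≤ r x := fun x => ENNReal.toReal_nonneg
  -- The optimal test function is log dμ/dν, truncated at level n. Where the density vanishes the
  -- value −n is imposed, since `Real.log 0 = 0` would give the wrong limit.
  set ψ : ℕ → α → ℝ := fun n x => if r x = 0 then -n else clip n (Real.log (r x)) with hψ
  have hψm : ∀ n, Measurable (ψ n) := fun n =>
    Measurable.ite (hrm (measurableSet_singleton 0)) measurable_const
      ((continuous_clip _).measurable.comp (Real.measurable_log.comp hrm))
  have hψC : ∀ n x, |ψ n x| ≤ n := fun n x => by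
    simp only [hψ]
    split_ifs
    · simp
    · exact abs_clip_le n.cast_nonneg _
  have hk : ∀ n x, 0 ≤ r x * ψ n x + 1 - Real.exp (ψ n x) := fun n x => by
    simp only [hψ]
    split_ifs with h0
    · simp [h0]
    · linarith [exp_sub_one_le_mul_clip_log n.cast_nonneg ((hr0 x).lt_of_ne' h0)]
  rw [klDiv_eq_lintegral_klFun_of_ac hac]
  have hlim : ∀ x, Tendsto (fun n => ENNReal.ofReal (r x * ψ n x + 1 - Real.exp (ψ n x))) atTop
      (𝓝 (ENNReal.ofReal (klFun (r x)))) := fun x => by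
    refine (ENNReal.continuous_ofReal.tendsto _).comp ?_
    by_cases h0 : r x = 0
    · simp only [hψ, h0, if_true, klFun_zero, zero_mul, zero_add]
      have : Tendsto (fun n : ℕ => Real.exp (-(n : ℝ))) atTop (𝓝 0) :=
        Real.tendsto_exp_neg_atTop_nhds_zero.comp tendsto_natCast_atTop_atTop
      simpa using this.const_sub 1
    · refine tendsto_const_nhds.congr' ?_
      filter_upwards [eventually_ge_atTop ⌈|Real.log (r x)|⌉₊] with n hn
      have : |Real.log (r x)| ≤ n := (Nat.le_ceil _).trans (by exact_mod_cast hn)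
      simp only [hψ, h0, if_false, clip_of_abs_le this, klFun_apply,
        Real.exp_log ((hr0 x).lt_of_ne' h0)]
  calc ∫⁻ x, ENNReal.ofReal (klFun (r x)) ∂ν
      = ∫⁻ x, liminf (fun n => ENNReal.ofReal (r x * ψ n x + 1 - Real.exp (ψ n x))) atTop ∂ν :=
        lintegral_congr fun x => (hlim x).liminf_eq.symm
    _ ≤ liminf (fun n => ∫⁻ x, ENNReal.ofReal (r x * ψ n x + 1 - Real.exp (ψ n x)) ∂ν) atTop :=
        lintegral_liminf_le fun n => by fun_prop
    _ ≤ liminf (fun _ : ℕ => ENNReal.ofReal L) atTop := by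
        refine liminf_le_liminf (Eventually.of_forall fun n => ?_)
        have hexp := integrable_exp_of_bounded (μ := ν) (hψm n) (hψC n)
        have hi : Integrable (fun x => r x * ψ n x) ν :=
          (integrable_rnDeriv_smul_iff hac).2 (integrable_of_bounded (hψm n) (hψC n))
        have he : ∫ x, r x * ψ n x ∂ν = ∫ x, ψ n x ∂μ := integral_rnDeriv_smul hac
        have hi1 : Integrable (fun x => r x * ψ n x + 1) ν := hi.add (integrable_const _)
        have hi2 : Integrable (fun x => r x * ψ n x + 1 - Real.exp (ψ n x)) ν := hi1.sub hexp
        rw [← ofReal_integral_eq_lintegral_ofReal hi2 (Eventually.of_forall (hk n)), integral_sub hi1 hexp, integral_add hi (integrable_const _),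
          he]
        refine ENNReal.ofReal_le_ofReal ?_
        have h1 := h (ψ n) n (hψm n) n.cast_nonneg (hψC n)
        -- Since log z ≤ z − 1, the integral ∫ ψ dμ + 1 − ∫ e^ψ dν is at most the Donsker–Varadhan
        -- functional.
        have h2 := Real.log_le_sub_one_of_pos (integral_exp_pos hexp)
        simp only [integral_const, probReal_univ, smul_eq_mul, one_mul]
        linarith
    _ = ENNReal.ofReal L := by simp

theorem klDiv_le_of_forall_boundedContinuous [TopologicalSpace α] [NormalSpace α] [BorelSpace α]
    (μ ν : Measure α) [IsProbabilityMeasure μ] [IsProbabilityMeasure ν] [(μ + ν).WeaklyRegular]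
    {L : ℝ} (h : ∀ φ : BoundedContinuousFunction α ℝ,
      ∫ x, φ x ∂μ - Real.log (∫ x, Real.exp (φ x) ∂ν) ≤ L) :
    klDiv μ ν ≤ ENNReal.ofReal L :=
  klDiv_le_of_forall_bounded μ ν fun _ _ hf hC0 hC =>
    sub_log_le_of_forall_boundedContinuous μ ν h hf hC0 hC

end Entropy

/-! ### Slicing the uniform measure on the sphere along one coordinate -/

section Sphere

theorem image_add_sq {A : Set ℝ} (hA : A = Set.Ioi 0 ∨ A = Set.Iio 0) (a : ℝ) :
    (fun t : ℝ => a + t ^ 2) '' A = Set.Ioi a := by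
  ext s
  simp only [Set.mem_image, Set.mem_Ioi]
  constructor
  · rintro ⟨t, ht, rfl⟩
    have : t ≠ 0 := by
      rcases hA with rfl | rfl
      · exact ht.ne'
      · exact ht.ne
    have := pow_pos (abs_pos.2 this) 2
    rw [sq_abs] at this
    linarith
  · intro hs
    have h0 : 0 < Real.sqrt (s - a) := Real.sqrt_pos.2 (by linarith)
    have h1 := Real.sq_sqrt (show 0 ≤ s - a by linarith)
    rcases hA with rfl | rfl
    · exact ⟨Real.sqrt (s - a), h0, by rw [h1]; ring⟩
    · exact ⟨-Real.sqrt (s - a), neg_lt_zero.2 h0, by rw [neg_sq, h1]; ring⟩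

theorem injOn_add_sq {A : Set ℝ} (hA : A = Set.Ioi 0 ∨ A = Set.Iio 0) (a : ℝ) :
    Set.InjOn (fun t : ℝ => a + t ^ 2) A := by
  intro x hx y hy hxy
  simp only [add_right_inj] at hxy
  rcases sq_eq_sq_iff_eq_or_eq_neg.1 hxy with h | h
  · exact h
  · rcases hA with rfl | rfl <;> simp only [Set.mem_Ioi, Set.mem_Iio] at hx hy <;> linarith

/-- The substitution `s = a + t²` on a half-line. -/
theorem setLIntegral_abs_mul_comp_add_sq {A : Set ℝ} (hA : A = Set.Ioi 0 ∨ A = Set.Iio 0)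
    (a : ℝ) (K : ℝ → ℝ≥0∞) :
    ∫⁻ t in A, ENNReal.ofReal |t| * K (a + t ^ 2) = 2⁻¹ * ∫⁻ s in Set.Ioi a, K s := by
  have hm : MeasurableSet A := by
    rcases hA with rfl | rfl
    · exact measurableSet_Ioi
    · exact measurableSet_Iio
  have h := lintegral_image_eq_lintegral_abs_deriv_mul hm (f := fun t : ℝ => a + t ^ 2)
    (f' := fun t => 2 * t) (fun x _ => by
      simpa using ((hasDerivAt_pow 2 x).const_add a).hasDerivWithinAt) (injOn_add_sq hA a) K
  rw [image_add_sq hA] at h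
  rw [h, ← lintegral_const_mul' _ _ (by simp)]
  refine lintegral_congr fun t => ?_
  rw [abs_mul, abs_two, ENNReal.ofReal_mul zero_le_two, ENNReal.ofReal_ofNat, ← mul_assoc,
    ← mul_assoc, ENNReal.inv_mul_cancel (by simp) (by simp), one_mul]

/-- Integration in polar coordinates. -/
theorem lintegral_eq_lintegral_toSphere {E : Type*} [NormedAddCommGroup E] [NormedSpace ℝ E]
    [MeasurableSpace E] [BorelSpace E] [FiniteDimensional ℝ E] [Nontrivial E] (μ : Measure E)
    [μ.IsAddHaarMeasure] {f : E → ℝ≥0∞} (hf : Measurable f) :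
    ∫⁻ x, f x ∂μ = ∫⁻ ω : Metric.sphere (0 : E) 1, (∫⁻ r in Set.Ioi (0 : ℝ),
      ENNReal.ofReal (r ^ (Module.finrank ℝ E - 1)) * f (r • (ω : E))) ∂μ.toSphere := by
  have hmp := (μ.measurePreserving_homeomorphUnitSphereProd).symm
    (homeomorphUnitSphereProd E).toMeasurableEquiv
  have h1 : ∫⁻ x, f x ∂μ = ∫⁻ x : ({0}ᶜ : Set E), f x ∂(μ.comap (↑)) := by
    rw [lintegral_subtype_comap (measurableSet_singleton (0 : E)).compl,
      restrict_compl_singleton]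
  have hfm : Measurable fun x : ({0}ᶜ : Set E) => f x := hf.comp measurable_subtype_coe
  rw [h1, ← hmp.lintegral_comp hfm, lintegral_prod]
  swap
  · exact (hfm.comp (homeomorphUnitSphereProd E).symm.measurable).aemeasurable
  refine lintegral_congr fun ω => ?_
  rw [Measure.volumeIoiPow, lintegral_withDensity_eq_lintegral_mul]
  · rw [← lintegral_subtype_comap measurableSet_Ioi]
    rfl
  · fun_prop
  · exact hfm.comp ((homeomorphUnitSphereProd E).symm.measurable.comp measurable_prodMk_left)

/-- Squared norm on `Fin n → ℝ`. -/
def sqSum {n : ℕ} (y : Fin n → ℝ) : ℝ := ∑ i, y i ^ 2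

@[fun_prop]
theorem measurable_sqSum {n : ℕ} : Measurable (sqSum (n := n)) := by
  unfold sqSum
  fun_prop

theorem sqSum_nonneg {n : ℕ} (y : Fin n → ℝ) : 0 ≤ sqSum y :=
  Finset.sum_nonneg fun _ _ => sq_nonneg _

theorem sqSum_smul {n : ℕ} (c : ℝ) (y : Fin n → ℝ) : sqSum (c • y) = c ^ 2 * sqSum y := by
  simp [sqSum, mul_pow, Finset.mul_sum]

theorem lintegral_comp_smul_pi {n : ℕ} {c : ℝ} (hc : 0 < c) {f : (Fin n → ℝ) → ℝ≥0∞}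
    (hf : Measurable f) :
    ∫⁻ y, f (c • y) = ENNReal.ofReal ((c ^ n)⁻¹) * ∫⁻ y, f y := by
  have h := Measure.map_addHaar_smul (volume : Measure (Fin n → ℝ)) hc.ne'
  rw [← lintegral_map hf (measurable_const_smul c), h, lintegral_smul_measure]
  simp [abs_of_pos hc]

theorem sqSum_removeNth_add {n : ℕ} (i : Fin (n + 1)) (x : Fin (n + 1) → ℝ) :
    sqSum (i.removeNth x) + x i ^ 2 = sqSum x := by
  simp only [sqSum]
  rw [Fin.sum_univ_succAbove _ i, add_comm]
  rfl

theorem lintegral_Ioo_ne_zero_ne_top {u : ℝ → ℝ} (hu : Measurable u)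
    (h0 : ∀ s ∈ Set.Ioo (0 : ℝ) 1, 0 < u s) (h1 : ∀ s ∈ Set.Ioo (0 : ℝ) 1, u s ≤ 1) :
    ∫⁻ s in Set.Ioo (0 : ℝ) 1, ENNReal.ofReal (u s) ≠ 0 ∧
      ∫⁻ s in Set.Ioo (0 : ℝ) 1, ENNReal.ofReal (u s) ≠ ∞ := by
  constructor
  · rw [← pos_iff_ne_zero, setLIntegral_pos_iff (by fun_prop)]
    refine lt_of_lt_of_le ?_ (measure_mono (?_ : Set.Ioo (0 : ℝ) 1 ⊆ _))
    · simp
    · intro s hs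
      refine ⟨?_, hs⟩
      simp only [Function.mem_support, ne_eq, ENNReal.ofReal_eq_zero, not_le]
      exact h0 s hs
  · refine ne_top_of_le_ne_top (b := 1) ENNReal.one_ne_top ?_
    calc ∫⁻ s in Set.Ioo (0 : ℝ) 1, ENNReal.ofReal (u s)
        ≤ ∫⁻ s in Set.Ioo (0 : ℝ) 1, 1 := by
          refine setLIntegral_mono' measurableSet_Ioo fun s hs => ?_
          rw [← ENNReal.ofReal_one]
          exact ENNReal.ofReal_le_ofReal (h1 s hs)
      _ = 1 := by simp

theorem measurableSet_halfLine {A : Set ℝ} (hA : A = Set.Ioi 0 ∨ A = Set.Iio 0) :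
    MeasurableSet A := by
  rcases hA with rfl | rfl
  · exact measurableSet_Ioi
  · exact measurableSet_Iio

theorem mul_mem_halfLine {A : Set ℝ} (hA : A = Set.Ioi 0 ∨ A = Set.Iio 0) {r : ℝ} (hr : 0 < r)
    (t : ℝ) : r * t ∈ A ↔ t ∈ A := by
  rcases hA with rfl | rfl
  · simp [hr]
  · simp [mul_neg_iff, hr, hr.not_gt]

theorem measurable_removeNth {n : ℕ} (i : Fin (n + 1)) :
    Measurable fun x : Fin (n + 1) → ℝ => i.removeNth x :=
  measurable_pi_lambda _ fun j => measurable_pi_apply (i.succAbove j)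

/-- Fubini for the substitution `s = sqSum y + t ^ 2` in the unit ball, followed by dilation of
the section. -/
theorem lintegral_ball_section {n : ℕ} {A : Set ℝ} (hA : A = Set.Ioi 0 ∨ A = Set.Iio 0)
    {Ψ : (Fin n → ℝ) → ℝ≥0∞} (hΨ : Measurable Ψ) :
    ∫⁻ y : Fin n → ℝ, ∫⁻ t in A, ENNReal.ofReal |t| *
        (Set.Iio (1 : ℝ)).indicator (fun s => Ψ ((Real.sqrt s)⁻¹ • y)) (sqSum y + t ^ 2) =
      2⁻¹ * ((∫⁻ s in Set.Ioo (0 : ℝ) 1, ENNReal.ofReal (Real.sqrt s ^ n)) *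
        ∫⁻ y in {y | sqSum y < 1}, Ψ y) := by
  have hBm : MeasurableSet {y : Fin n → ℝ | sqSum y < 1} :=
    measurableSet_lt measurable_sqSum measurable_const
  set Φ := {y : Fin n → ℝ | sqSum y < 1}.indicator Ψ with hΦ
  have hΦm : Measurable Φ := hΨ.indicator hBm
  -- After s = |y|² + t² the constraint s > |y|² says exactly that y/√s lies in the unit ball, so
  -- the extension Φ of Ψ by zero carries it.
  have h1 : ∀ y : Fin n → ℝ, ∫⁻ t in A, ENNReal.ofReal |t| *
        (Set.Iio (1 : ℝ)).indicator (fun s => Ψ ((Real.sqrt s)⁻¹ • y)) (sqSum y + t ^ 2) =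
      2⁻¹ * ∫⁻ s in Set.Ioo (0 : ℝ) 1, Φ ((Real.sqrt s)⁻¹ • y) := fun y => by
    rw [setLIntegral_abs_mul_comp_add_sq hA, ← lintegral_indicator measurableSet_Ioi,
      ← lintegral_indicator measurableSet_Ioo]
    congr 1
    refine lintegral_congr fun s => ?_
    by_cases hs : s ∈ Set.Ioo (0 : ℝ) 1
    · have hlt : sqSum ((Real.sqrt s)⁻¹ • y) < 1 ↔ sqSum y < s := by
        rw [sqSum_smul, inv_pow, Real.sq_sqrt hs.1.le, inv_mul_lt_iff₀ hs.1, mul_one]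
      by_cases h : sqSum y < s
      · rw [Set.indicator_of_mem (show s ∈ Set.Ioi (sqSum y) from h),
          Set.indicator_of_mem hs, Set.indicator_of_mem (show s ∈ Set.Iio (1 : ℝ) from hs.2), hΦ,
          Set.indicator_of_mem (show _ ∈ {y | sqSum y < 1} from hlt.2 h)]
      · rw [Set.indicator_of_notMem (show s ∉ Set.Ioi (sqSum y) from h),
          Set.indicator_of_mem hs, hΦ,
          Set.indicator_of_notMem (show _ ∉ {y | sqSum y < 1} from fun h' => h (hlt.1 h'))]
    · rw [Set.indicator_of_notMem hs]
      by_cases h : sqSum y < s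
      · rw [Set.indicator_of_mem (show s ∈ Set.Ioi (sqSum y) from h),
          Set.indicator_of_notMem]
        exact fun h' => hs ⟨(sqSum_nonneg y).trans_lt h, h'⟩
      · rw [Set.indicator_of_notMem (show s ∉ Set.Ioi (sqSum y) from h)]
  simp_rw [h1]
  rw [lintegral_const_mul' _ _ (by simp), lintegral_lintegral_swap (by fun_prop)]
  congr 1
  rw [← lintegral_indicator hBm, ← lintegral_mul_const _ (by fun_prop)]
  refine setLIntegral_congr_fun measurableSet_Ioo fun s hs => ?_
  have hs0 := Real.sqrt_pos.2 hs.1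
  rw [lintegral_comp_smul_pi (inv_pos.2 hs0) hΦm, inv_pow, inv_inv]

/-- One function on the unit ball, |x_i| Ψ(x'/|x|) with x' the vector without x_i, is integrated in
two ways. In polar coordinates it is homogeneous of degree 1, so the radial integral c₁ splits off;
in Cartesian coordinates `lintegral_ball_section` applies. -/
theorem unitSphere_slice (n : ℕ) : ∃ c : ℝ≥0∞, c ≠ 0 ∧ c ≠ ∞ ∧
    ∀ (i : Fin (n + 1)) (A : Set ℝ), (A = Set.Ioi 0 ∨ A = Set.Iio 0) →
      ∀ Ψ : (Fin n → ℝ) → ℝ≥0∞, Measurable Ψ →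
      ∫⁻ ω : Metric.sphere (0 : EuclideanSpace ℝ (Fin (n + 1))) 1,
        A.indicator (fun t => ENNReal.ofReal |t|) ((ω : EuclideanSpace ℝ (Fin (n + 1))) i) *
          Ψ (i.removeNth (WithLp.ofLp (ω : EuclideanSpace ℝ (Fin (n + 1)))))
        ∂(volume : Measure (EuclideanSpace ℝ (Fin (n + 1)))).toSphere =
      c * ∫⁻ y in {y | sqSum y < 1}, Ψ y := by
  set c₁ := ∫⁻ s in Set.Ioo (0 : ℝ) 1, ENNReal.ofReal (s ^ (n + 1)) with hc₁
  set c₂ := ∫⁻ s in Set.Ioo (0 : ℝ) 1, ENNReal.ofReal (Real.sqrt s ^ n) with hc₂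
  obtain ⟨h10, h1t⟩ : c₁ ≠ 0 ∧ c₁ ≠ ∞ := lintegral_Ioo_ne_zero_ne_top (by fun_prop)
    (fun s hs => pow_pos hs.1 _) fun s hs => pow_le_one₀ hs.1.le hs.2.le
  obtain ⟨h20, h2t⟩ : c₂ ≠ 0 ∧ c₂ ≠ ∞ := lintegral_Ioo_ne_zero_ne_top (by fun_prop)
    (fun s hs => pow_pos (Real.sqrt_pos.2 hs.1) _) fun s hs =>
      pow_le_one₀ (Real.sqrt_nonneg _) (Real.sqrt_le_one.2 hs.2.le)
  refine ⟨c₁⁻¹ * (2⁻¹ * c₂), by simp [h20, h1t], by finiteness, fun i A hA Ψ hΨ => ?_⟩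
  have hAm := measurableSet_halfLine hA
  set F : EuclideanSpace ℝ (Fin (n + 1)) → ℝ≥0∞ := fun x =>
    A.indicator (fun t => ENNReal.ofReal |t|) (x i) *
      (Set.Iio (1 : ℝ)).indicator
        (fun s => Ψ ((Real.sqrt s)⁻¹ • i.removeNth (WithLp.ofLp x))) (sqSum (WithLp.ofLp x)) with hF
  have hind : Measurable (A.indicator fun t : ℝ => ENNReal.ofReal |t|) :=
    Measurable.indicator (by fun_prop) hAm
  have hrm : Measurable fun x : EuclideanSpace ℝ (Fin (n + 1)) => i.removeNth (WithLp.ofLp x) :=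
    (measurable_removeNth i).comp (WithLp.measurable_ofLp 2 _)
  have hsq : Measurable fun x : EuclideanSpace ℝ (Fin (n + 1)) => sqSum (WithLp.ofLp x) :=
    measurable_sqSum.comp (WithLp.measurable_ofLp 2 _)
  have hFm : Measurable F := by
    refine (hind.comp (by fun_prop)).mul ?_
    exact Measurable.ite (hsq measurableSet_Iio)
      (hΨ.comp ((Real.continuous_sqrt.measurable.comp hsq).inv.smul hrm)) measurable_const
  have hpolar := lintegral_eq_lintegral_toSphere volume hFm
  have hcart : ∫⁻ x, F x = 2⁻¹ * (c₂ * ∫⁻ y in {y | sqSum y < 1}, Ψ y) := by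
    have hF2 : Measurable fun a => F (WithLp.toLp 2 a) := hFm.comp (WithLp.measurable_toLp 2 _)
    rw [← lintegral_ball_section hA hΨ,
      ← (PiLp.volume_preserving_toLp (Fin (n + 1))).lintegral_comp hFm,
      ← ((volume_preserving_piFinSuccAbove (fun _ => ℝ) i).symm _).lintegral_comp hF2,
      Measure.volume_eq_prod, lintegral_prod_symm']
    swap
    · exact hF2.comp (MeasurableEquiv.measurable _)
    refine lintegral_congr fun y => ?_
    rw [← lintegral_indicator hAm]
    refine lintegral_congr fun t => ?_
    have h1 : ((MeasurableEquiv.piFinSuccAbove (fun _ => ℝ) i).symm (t, y)) i = t :=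
      Fin.insertNth_apply_same (α := fun _ => ℝ) i t y
    have h2 : i.removeNth ((MeasurableEquiv.piFinSuccAbove (fun _ => ℝ) i).symm (t, y)) = y :=
      Fin.removeNth_insertNth (α := fun _ => ℝ) i t y
    have h3 : sqSum ((MeasurableEquiv.piFinSuccAbove (fun _ => ℝ) i).symm (t, y)) =
        sqSum y + t ^ 2 := by
      rw [← sqSum_removeNth_add i, h1, h2]
    simp only [hF]
    rw [h1, h2, h3]
    by_cases ht : t ∈ A <;> simp [ht]
  have hsph : ∫⁻ x, F x = c₁ * ∫⁻ ω : Metric.sphere (0 : EuclideanSpace ℝ (Fin (n + 1))) 1,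
        A.indicator (fun t => ENNReal.ofReal |t|) ((ω : EuclideanSpace ℝ (Fin (n + 1))) i) *
          Ψ (i.removeNth (WithLp.ofLp (ω : EuclideanSpace ℝ (Fin (n + 1)))))
        ∂(volume : Measure (EuclideanSpace ℝ (Fin (n + 1)))).toSphere := by
    rw [hpolar, ← lintegral_const_mul' _ _ h1t]
    refine lintegral_congr fun ω => ?_
    have hω : sqSum (WithLp.ofLp (ω : EuclideanSpace ℝ (Fin (n + 1)))) = 1 := by
      have := ω.2
      rw [mem_sphere_zero_iff_norm] at this
      have h2 := EuclideanSpace.norm_sq_eq (ω : EuclideanSpace ℝ (Fin (n + 1)))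
      rw [this] at h2
      simpa [sqSum] using h2.symm
    rw [hc₁, ← lintegral_mul_const _ (by fun_prop), ← lintegral_indicator measurableSet_Ioi,
      ← lintegral_indicator measurableSet_Ioo]
    refine lintegral_congr fun r => ?_
    by_cases hr : 0 < r
    swap
    · rw [Set.indicator_of_notMem (show r ∉ Set.Ioi 0 from hr),
        Set.indicator_of_notMem (fun h => hr h.1)]
    have h3 : sqSum (WithLp.ofLp (r • (ω : EuclideanSpace ℝ (Fin (n + 1))))) = r ^ 2 := by
      rw [WithLp.ofLp_smul, sqSum_smul, hω, mul_one]
    have h4 : (Real.sqrt (r ^ 2))⁻¹ • i.removeNth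
        (WithLp.ofLp (r • (ω : EuclideanSpace ℝ (Fin (n + 1))))) =
        i.removeNth (WithLp.ofLp (ω : EuclideanSpace ℝ (Fin (n + 1)))) := by
      rw [Real.sqrt_sq hr.le]
      ext j
      simp [Fin.removeNth, hr.ne']
    rw [Set.indicator_of_mem (show r ∈ Set.Ioi 0 from hr)]
    simp only [hF]
    rw [h3]
    by_cases hr1 : r < 1
    swap
    · rw [Set.indicator_of_notMem (show r ∉ Set.Ioo 0 1 from fun h => hr1 h.2),
        Set.indicator_of_notMem (s := Set.Iio (1 : ℝ)), mul_zero, mul_zero]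
      simp only [Set.mem_Iio, not_lt]
      exact one_le_pow₀ (not_lt.1 hr1)
    rw [Set.indicator_of_mem (show r ∈ Set.Ioo 0 1 from ⟨hr, hr1⟩),
      Set.indicator_of_mem (s := Set.Iio (1 : ℝ))
        (show r ^ 2 ∈ Set.Iio (1 : ℝ) from pow_lt_one₀ hr.le hr1 two_ne_zero), h4]
    have h5 : (r • (ω : EuclideanSpace ℝ (Fin (n + 1)))) i =
      r * (ω : EuclideanSpace ℝ (Fin (n + 1))) i := by simp
    rw [h5]
    by_cases hm : (ω : EuclideanSpace ℝ (Fin (n + 1))) i ∈ A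
    · rw [Set.indicator_of_mem hm, Set.indicator_of_mem ((mul_mem_halfLine hA hr _).2 hm),
        abs_mul, abs_of_pos hr, ENNReal.ofReal_mul hr.le, finrank_euclideanSpace_fin,
        Nat.add_sub_cancel, pow_succ, ENNReal.ofReal_mul (by positivity)]
      ring
    · rw [Set.indicator_of_notMem hm,
        Set.indicator_of_notMem fun h => hm ((mul_mem_halfLine hA hr _).1 h)]
      simp
  rw [hsph] at hcart
  rw [mul_assoc, mul_assoc, ← hcart, ← mul_assoc, ENNReal.inv_mul_cancel h10 h1t, one_mul]

theorem toSphere_univ_ne_zero_ne_top (n : ℕ) :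
    (volume : Measure (EuclideanSpace ℝ (Fin (n + 1)))).toSphere Set.univ ≠ 0 ∧
      (volume : Measure (EuclideanSpace ℝ (Fin (n + 1)))).toSphere Set.univ ≠ ∞ :=
  ⟨Measure.measure_univ_ne_zero.2 (Measure.toSphere_ne_zero _), measure_ne_top _ _⟩

theorem continuous_dilate (N : ℕ) : Continuous (dilate N) := by
  unfold dilate
  fun_prop

instance isProbabilityMeasure_unif (n : ℕ) : IsProbabilityMeasure (unif (n + 1)) := by
  obtain ⟨h0, ht⟩ := toSphere_univ_ne_zero_ne_top n
  refine ⟨?_⟩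
  rw [unif, Measure.smul_apply, Measure.map_apply (continuous_dilate _).measurable MeasurableSet.univ,
    Set.preimage_univ, smul_eq_mul, ENNReal.inv_mul_cancel h0 ht]

/-- The image of `|v_i| dσ^N`, restricted to one of the half-spheres `v_i > 0`, `v_i < 0`, under
the projection removing `v_i` is a multiple of Lebesgue measure on the ball. -/
theorem unif_slice (n : ℕ) : ∃ c : ℝ≥0∞, c ≠ 0 ∧ c ≠ ∞ ∧
    ∀ (i : Fin (n + 1)) (A : Set ℝ), (A = Set.Ioi 0 ∨ A = Set.Iio 0) →
      ∀ Ψ : (Fin n → ℝ) → ℝ≥0∞, Measurable Ψ →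
      ∫⁻ v : KacSphere (n + 1),
        A.indicator (fun t => ENNReal.ofReal |t|) ((v : EuclideanSpace ℝ (Fin (n + 1))) i) *
          Ψ (i.removeNth (WithLp.ofLp (v : EuclideanSpace ℝ (Fin (n + 1))))) ∂(unif (n + 1)) =
      c * ∫⁻ y in {y | sqSum y < n + 1}, Ψ y := by
  obtain ⟨c, hc0, hct, hc⟩ := unitSphere_slice n
  obtain ⟨h0, ht⟩ := toSphere_univ_ne_zero_ne_top n
  set S := (volume : Measure (EuclideanSpace ℝ (Fin (n + 1)))).toSphere Set.univ with hS
  set ρ := Real.sqrt ((n + 1 : ℕ) : ℝ) with hρ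
  have hρ0 : 0 < ρ := Real.sqrt_pos.2 (by positivity)
  have hρ2 : ρ ^ 2 = n + 1 := by
    rw [hρ, Real.sq_sqrt (by positivity)]
    push_cast
    rfl
  -- The three factors are the normalization of the surface measure, the scaling of |v_i|, and the
  -- Jacobian of the dilation in dimension n.
  refine ⟨S⁻¹ * (ENNReal.ofReal ρ * (c * ENNReal.ofReal ((ρ ^ n)⁻¹))), ?_, by finiteness,
    fun i A hA Ψ hΨ => ?_⟩
  · simp [hc0, ht, hρ0]
  have hind : Measurable (A.indicator fun t : ℝ => ENNReal.ofReal |t|) :=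
    Measurable.indicator (by fun_prop) (measurableSet_halfLine hA)
  have hm : Measurable fun v : KacSphere (n + 1) =>
      A.indicator (fun t => ENNReal.ofReal |t|) ((v : EuclideanSpace ℝ (Fin (n + 1))) i) *
        Ψ (i.removeNth (WithLp.ofLp (v : EuclideanSpace ℝ (Fin (n + 1))))) :=
    (hind.comp (by fun_prop)).mul (hΨ.comp ((measurable_removeNth i).comp
      ((WithLp.measurable_ofLp 2 _).comp measurable_subtype_coe)))
  rw [unif, lintegral_smul_measure, lintegral_map hm (continuous_dilate _).measurable, smul_eq_mul,
    mul_assoc]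
  congr 1
  have hscale : ∀ ω : Metric.sphere (0 : EuclideanSpace ℝ (Fin (n + 1))) 1,
      A.indicator (fun t => ENNReal.ofReal |t|)
        ((dilate (n + 1) ω : EuclideanSpace ℝ (Fin (n + 1))) i) *
        Ψ (i.removeNth (WithLp.ofLp (dilate (n + 1) ω : EuclideanSpace ℝ (Fin (n + 1))))) =
      ENNReal.ofReal ρ * (A.indicator (fun t => ENNReal.ofReal |t|)
        ((ω : EuclideanSpace ℝ (Fin (n + 1))) i) *
        Ψ (ρ • i.removeNth (WithLp.ofLp (ω : EuclideanSpace ℝ (Fin (n + 1)))))) := fun ω => by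
    have h1 : (dilate (n + 1) ω : EuclideanSpace ℝ (Fin (n + 1))) i =
      ρ * (ω : EuclideanSpace ℝ (Fin (n + 1))) i := by simp [dilate, hρ]
    have h2 : i.removeNth (WithLp.ofLp (dilate (n + 1) ω : EuclideanSpace ℝ (Fin (n + 1)))) =
        ρ • i.removeNth (WithLp.ofLp (ω : EuclideanSpace ℝ (Fin (n + 1)))) := rfl
    rw [h1, h2]
    by_cases h : (ω : EuclideanSpace ℝ (Fin (n + 1))) i ∈ A
    · rw [Set.indicator_of_mem h, Set.indicator_of_mem ((mul_mem_halfLine hA hρ0 _).2 h), abs_mul,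
        abs_of_pos hρ0, ENNReal.ofReal_mul hρ0.le, mul_assoc]
    · rw [Set.indicator_of_notMem h,
        Set.indicator_of_notMem fun h' => h ((mul_mem_halfLine hA hρ0 _).1 h')]
      simp
  simp_rw [hscale]
  rw [lintegral_const_mul' _ _ (by simp),
    hc i A hA (fun y => Ψ (ρ • y)) (hΨ.comp (measurable_const_smul ρ)), mul_assoc, mul_assoc]
  congr 2
  have hB : MeasurableSet {y : Fin n → ℝ | sqSum y < 1} :=
    measurableSet_lt measurable_sqSum measurable_const
  have hB' : MeasurableSet {y : Fin n → ℝ | sqSum y < n + 1} :=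
    measurableSet_lt measurable_sqSum measurable_const
  rw [← lintegral_indicator hB, ← lintegral_indicator hB',
    ← lintegral_comp_smul_pi hρ0 (hΨ.indicator hB')]
  refine lintegral_congr fun y => ?_
  have : sqSum (ρ • y) < n + 1 ↔ sqSum y < 1 := by
    rw [sqSum_smul, hρ2, mul_lt_iff_lt_one_right (by positivity)]
  simp only [Set.indicator, Set.mem_ofPred_eq, this]

end Sphere

/-! ### Product measures and product densities -/

section Products

theorem lintegral_prod_pi {n : ℕ} {α : Fin n → Type*} [∀ i, MeasurableSpace (α i)]
    (μ : ∀ i, Measure (α i)) [∀ i, SigmaFinite (μ i)] {f : ∀ i, α i → ℝ≥0∞}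
    (hf : ∀ i, Measurable (f i)) :
    ∫⁻ y, ∏ i, f i (y i) ∂(Measure.pi μ) = ∏ i, ∫⁻ t, f i t ∂(μ i) := by
  induction n with
  | zero => simp
  | succ n ih =>
    rw [← ((measurePreserving_piFinSuccAbove μ 0).symm _).lintegral_comp (by fun_prop),
      lintegral_prod _ (by fun_prop), Fin.prod_univ_succ]
    simp_rw [Fin.prod_univ_succ]
    change ∫⁻ t, ∫⁻ y : (∀ i : Fin n, α (Fin.succ i)), f 0 t * ∏ i : Fin n, f i.succ (y i)
      ∂(Measure.pi fun j => μ (Fin.succ j)) ∂(μ 0) = _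
    have hm : Measurable fun y : ∀ i : Fin n, α (Fin.succ i) => ∏ i : Fin n, f i.succ (y i) := by
      fun_prop
    simp_rw [lintegral_const_mul _ hm]
    rw [lintegral_mul_const _ (hf 0)]
    congr 1
    exact ih (fun i => μ i.succ) fun i => hf i.succ

theorem pi_withDensity {n : ℕ} {f : Fin n → ℝ → ℝ≥0∞} (hf : ∀ i, Measurable (f i))
    [∀ i, SigmaFinite ((volume : Measure ℝ).withDensity (f i))] :
    Measure.pi (fun i => (volume : Measure ℝ).withDensity (f i)) =
      (volume : Measure (Fin n → ℝ)).withDensity fun y => ∏ i, f i (y i) := by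
  refine Measure.pi_eq fun s hs => ?_
  rw [withDensity_apply _ (MeasurableSet.univ_pi hs),
    ← lintegral_indicator (MeasurableSet.univ_pi hs)]
  have : ∀ y : Fin n → ℝ, (Set.univ.pi s).indicator (fun y => ∏ i, f i (y i)) y =
      ∏ i, (s i).indicator (f i) (y i) := fun y => by
    by_cases hy : y ∈ Set.univ.pi s
    · rw [Set.indicator_of_mem hy]
      exact Finset.prod_congr rfl fun i _ => (Set.indicator_of_mem (hy i trivial) _).symm
    · rw [Set.indicator_of_notMem hy]
      simp only [Set.mem_pi, Set.mem_univ, true_implies, not_forall] at hy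
      obtain ⟨i, hi⟩ := hy
      exact (Finset.prod_eq_zero (Finset.mem_univ i) (Set.indicator_of_notMem hi _)).symm
  simp_rw [this]
  rw [volume_pi, lintegral_prod_pi _ fun i => (hf i).indicator (hs i)]
  refine Finset.prod_congr rfl fun i _ => ?_
  rw [lintegral_indicator (hs i), withDensity_apply _ (hs i)]

end Products

/-! ### The law of the energy and its link with Z -/

section Density

theorem sqSum_coe {N : ℕ} (v : KacSphere N) :
    sqSum (WithLp.ofLp (v : EuclideanSpace ℝ (Fin N))) = N := by
  have h := v.2
  rw [mem_sphere_zero_iff_norm] at h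
  have h2 := EuclideanSpace.norm_sq_eq (v : EuclideanSpace ℝ (Fin N))
  rw [h, Real.sq_sqrt (Nat.cast_nonneg N)] at h2
  simpa [sqSum] using h2.symm

variable {g : ℝ → ℝ}

/-- The density of the law of `v ^ 2` when `v` has density `g`. -/
noncomputable def sqDensity (g : ℝ → ℝ) (s : ℝ) : ℝ≥0∞ :=
  if 0 < s then 2⁻¹ * ((ENNReal.ofReal (g (Real.sqrt s)) + ENNReal.ofReal (g (-Real.sqrt s))) /
    ENNReal.ofReal (Real.sqrt s)) else 0

theorem measurable_sqDensity (hg : Measurable g) : Measurable (sqDensity g) := by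
  unfold sqDensity
  exact Measurable.ite measurableSet_Ioi (by fun_prop) measurable_const

theorem sqDensity_of_nonpos {s : ℝ} (hs : s ≤ 0) : sqDensity g s = 0 := if_neg hs.not_gt

/-- The operator `F ↦ ∫ F(w - v²) g(v) dv` is convolution with `sqDensity g`. -/
theorem lintegral_comp_sub_sq (hg : Measurable g) {F : ℝ → ℝ≥0∞} (hF : Measurable F) (w : ℝ) :
    ∫⁻ v, F (w - v ^ 2) ∂(densityMeasure g) = (sqDensity g ⋆ₗ F) w := by
  have key : ∀ A : Set ℝ, (A = Set.Ioi 0 ∨ A = Set.Iio 0) → ∀ σ : ℝ,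
      (∀ t ∈ A, t = σ * Real.sqrt (t ^ 2)) →
      ∫⁻ t in A, ENNReal.ofReal (g t) * F (w - t ^ 2) = 2⁻¹ * ∫⁻ s in Set.Ioi 0,
        ENNReal.ofReal (g (σ * Real.sqrt s)) / ENNReal.ofReal (Real.sqrt s) * F (w - s) := by
    intro A hA σ hσ
    have := setLIntegral_abs_mul_comp_add_sq hA 0 (fun s =>
        ENNReal.ofReal (g (σ * Real.sqrt s)) / ENNReal.ofReal (Real.sqrt s) * F (w - s))
    rw [← this]
    refine setLIntegral_congr_fun (measurableSet_halfLine hA) fun t ht => ?_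
    have h0 : t ≠ 0 := by
      rcases hA with rfl | rfl
      · exact ht.ne'
      · exact ht.ne
    simp only [zero_add]
    rw [← hσ t ht, Real.sqrt_sq_eq_abs, ← mul_assoc, ENNReal.mul_div_cancel (by simpa using h0)
      (by simp)]
  have h1 := key _ (Or.inl rfl) 1 fun t ht => by
    rw [Real.sqrt_sq_eq_abs, abs_of_pos ht, one_mul]
  have h2 := key _ (Or.inr rfl) (-1) fun t ht => by
    rw [Real.sqrt_sq_eq_abs, abs_of_neg ht]
    ring
  rw [densityMeasure, lintegral_withDensity_eq_lintegral_mul _ (by fun_prop) (by fun_prop)]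
  simp only [Pi.mul_apply]
  have hsplit : ∫⁻ t, ENNReal.ofReal (g t) * F (w - t ^ 2) =
      (∫⁻ t in Set.Ioi 0, ENNReal.ofReal (g t) * F (w - t ^ 2)) +
        ∫⁻ t in Set.Iio 0, ENNReal.ofReal (g t) * F (w - t ^ 2) := by
    rw [← lintegral_add_compl _ (measurableSet_Ioi (a := (0 : ℝ))), Set.compl_Ioi,
      setLIntegral_congr (Iio_ae_eq_Iic (a := (0 : ℝ)) (μ := volume))]
  rw [hsplit, h1, h2, ← mul_add, ← lintegral_add_left (by fun_prop),
    ← lintegral_const_mul' _ _ (by simp), lconvolution_def, ← lintegral_indicator measurableSet_Ioi]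
  refine lintegral_congr fun s => ?_
  by_cases hs : 0 < s
  · rw [Set.indicator_of_mem (show s ∈ Set.Ioi 0 from hs), sqDensity, if_pos hs, ← add_mul,
      ENNReal.div_add_div_same, mul_assoc]
    simp only [one_mul, neg_mul]
    rw [show -s + w = w - s by ring]
  · rw [Set.indicator_of_notMem (show s ∉ Set.Ioi 0 from hs), sqDensity, if_neg hs, zero_mul]

theorem isProbabilityMeasure_densityMeasure (hg0 : ∀ x, 0 ≤ g x)
    (h1 : ∫ x, g x = 1) : IsProbabilityMeasure (densityMeasure g) := by
  have hi : Integrable g := by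
    by_contra h
    rw [integral_undef h] at h1
    exact zero_ne_one h1
  refine ⟨?_⟩
  rw [densityMeasure, withDensity_apply _ MeasurableSet.univ, setLIntegral_univ,
    ← ofReal_integral_eq_lintegral_ofReal hi (Eventually.of_forall hg0), h1, ENNReal.ofReal_one]

theorem measurable_iterate_lconvolution {h F : ℝ → ℝ≥0∞} (hh : Measurable h) (hF : Measurable F)
    (n : ℕ) : Measurable ((fun F => h ⋆ₗ F)^[n] F) := by
  induction n with
  | zero => exact hF
  | succ n ih =>
    rw [Function.iterate_succ_apply']
    exact measurable_lconvolution _ hh ih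

/-- Associativity of convolution. Note the shift: the n-th iterate started at h is the (n+1)-fold
convolution power of h. -/
theorem iterate_succ_lconvolution {h F : ℝ → ℝ≥0∞} (hh : Measurable h) (hF : Measurable F)
    (n : ℕ) : (fun F => h ⋆ₗ F)^[n + 1] F = ((fun F => h ⋆ₗ F)^[n] h) ⋆ₗ F := by
  induction n with
  | zero => rfl
  | succ n ih =>
    rw [Function.iterate_succ_apply', ih, Function.iterate_succ_apply' _ n h]
    exact lconvolution_assoc hh (measurable_iterate_lconvolution hh hh n) hF

theorem lintegral_pi_comp_sub_sqSum (hg : Measurable g) [IsProbabilityMeasure (densityMeasure g)]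
    {F : ℝ → ℝ≥0∞} (hF : Measurable F) (n : ℕ) (w : ℝ) :
    ∫⁻ y : Fin n → ℝ, F (w - sqSum y) ∂(Measure.pi fun _ => densityMeasure g) =
      ((fun F => sqDensity g ⋆ₗ F)^[n] F) w := by
  induction n generalizing w with
  | zero => simp [sqSum]
  | succ n ih =>
    rw [Function.iterate_succ_apply', ← lintegral_comp_sub_sq hg
      (measurable_iterate_lconvolution (measurable_sqDensity hg) hF n),
      ← ((measurePreserving_piFinSuccAbove (fun _ => densityMeasure g) 0).symm _).lintegral_comp
        (by fun_prop), lintegral_prod _ (by fun_prop)]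
    refine lintegral_congr fun t => ?_
    rw [← ih]
    refine lintegral_congr fun y => ?_
    congr 1
    simp [sqSum, Fin.sum_univ_succ, MeasurableEquiv.piFinSuccAbove, sub_sub]

/-- The constant of `unif_slice`. -/
noncomputable def sliceConst (n : ℕ) : ℝ≥0∞ := (unif_slice n).choose

/-- Given the other n coordinates, |v_0| is fixed by the sphere, so slicing along v_0 produces
g(±√s)/√s at s = n + 1 − |y|². Summed over the two signs, this is twice the density of v_0² at s. -/
theorem le_Z (hg : Measurable g) [IsProbabilityMeasure (densityMeasure g)] (n : ℕ) :
    sliceConst n * ((fun F => sqDensity g ⋆ₗ F)^[n] (sqDensity g)) (n + 1) ≤ Z g (n + 1) := by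
  have hsl := (unif_slice n).choose_spec.2.2
  rw [← lintegral_pi_comp_sub_sqSum hg (measurable_sqDensity hg)]
  have hG : Measurable fun y : Fin n → ℝ => ∏ j, ENNReal.ofReal (g (y j)) := by fun_prop
  set Ψ : ℝ → (Fin n → ℝ) → ℝ≥0∞ := fun σ y =>
    ENNReal.ofReal (g (σ * Real.sqrt (n + 1 - sqSum y))) /
      ENNReal.ofReal (Real.sqrt (n + 1 - sqSum y)) * ∏ j, ENNReal.ofReal (g (y j)) with hΨ
  have hΨm : ∀ σ, Measurable (Ψ σ) := fun σ => by fun_prop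
  have hB : MeasurableSet {y : Fin n → ℝ | sqSum y < n + 1} :=
    measurableSet_lt measurable_sqSum measurable_const
  have : SigmaFinite ((volume : Measure ℝ).withDensity fun v => ENNReal.ofReal (g v)) :=
    inferInstanceAs (SigmaFinite (densityMeasure g))
  have hν : Measure.pi (fun _ : Fin n => densityMeasure g) =
      (volume : Measure (Fin n → ℝ)).withDensity fun y => ∏ j, ENNReal.ofReal (g (y j)) :=
    pi_withDensity fun _ => by fun_prop
  have h1 : ∫⁻ y : Fin n → ℝ, sqDensity g (n + 1 - sqSum y)
      ∂(Measure.pi fun _ => densityMeasure g) ≤ ∫⁻ y in {y | sqSum y < n + 1}, (Ψ 1 y + Ψ (-1) y) := by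
    have hm : Measurable fun y : Fin n → ℝ => sqDensity g (n + 1 - sqSum y) :=
      (measurable_sqDensity hg).comp (by fun_prop)
    rw [hν, lintegral_withDensity_eq_lintegral_mul _ hG hm, ← lintegral_indicator hB]
    refine lintegral_mono fun y => ?_
    simp only [Pi.mul_apply]
    by_cases hy : sqSum y < n + 1
    · rw [Set.indicator_of_mem (show y ∈ {y | sqSum y < n + 1} from hy), sqDensity,
        if_pos (by linarith)]
      simp only [hΨ]
      rw [← add_mul, ENNReal.div_add_div_same, mul_comm, one_mul, neg_one_mul]
      -- The factor 1/2 in `sqDensity` is simply discarded; a lower bound on Z is all that is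
      -- wanted.
      refine mul_le_mul_left (mul_le_of_le_one_left bot_le ?_) _
      simp
    · rw [sqDensity_of_nonpos (by linarith), mul_zero]
      exact bot_le
  refine (mul_le_mul_right h1 _).trans ?_
  rw [lintegral_add_left (hΨm 1), mul_add, sliceConst, ← hsl 0 _ (Or.inl rfl) _ (hΨm 1),
    ← hsl 0 _ (Or.inr rfl) _ (hΨm (-1)), ← lintegral_add_left]
  swap
  · exact ((Measurable.indicator (by fun_prop) measurableSet_Ioi).comp (by fun_prop)).mul
      ((hΨm 1).comp ((measurable_removeNth 0).comp
        ((WithLp.measurable_ofLp 2 _).comp measurable_subtype_coe)))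
  refine lintegral_mono fun v => ?_
  have hv := sqSum_coe v
  set x := WithLp.ofLp (v : EuclideanSpace ℝ (Fin (n + 1))) with hx
  have hs : n + 1 - sqSum (Fin.removeNth 0 x) = x 0 ^ 2 := by
    have := sqSum_removeNth_add 0 x
    rw [hv] at this
    push_cast at this
    linarith
  have hprod : tensorDensity g (n + 1) v = ENNReal.ofReal (g (x 0)) *
      ∏ j, ENNReal.ofReal (g (Fin.removeNth 0 x j)) := by
    simp only [tensorDensity]
    rw [Fin.prod_univ_succ]
    rfl
  have hval : ∀ σ, x 0 ≠ 0 → x 0 = σ * Real.sqrt (x 0 ^ 2) →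
      ENNReal.ofReal |x 0| * Ψ σ (Fin.removeNth 0 x) = tensorDensity g (n + 1) v := fun σ h0 h => by
    simp only [hΨ]
    rw [hs, hprod, ← mul_assoc, ← h, Real.sqrt_sq_eq_abs,
      ENNReal.mul_div_cancel (by simpa using h0) (by simp)]
  rcases lt_trichotomy (x 0) 0 with h | h | h
  · rw [Set.indicator_of_notMem (show x 0 ∉ Set.Ioi 0 from h.le.not_gt),
      Set.indicator_of_mem (show x 0 ∈ Set.Iio 0 from h), zero_mul, zero_add,
      hval _ h.ne (by rw [Real.sqrt_sq_eq_abs, abs_of_neg h]; ring)]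
  · rw [Set.indicator_of_notMem (show x 0 ∉ Set.Ioi 0 from h.le.not_gt),
      Set.indicator_of_notMem (show x 0 ∉ Set.Iio 0 from h.ge.not_gt), zero_mul, zero_add]
    simp
  · rw [Set.indicator_of_notMem (show x 0 ∉ Set.Iio 0 from h.le.not_gt),
      Set.indicator_of_mem (show x 0 ∈ Set.Ioi 0 from h), zero_mul, add_zero,
      hval _ h.ne' (by rw [Real.sqrt_sq_eq_abs, abs_of_pos h]; ring)]

end Density

/-! ### Pointwise lower bounds for convolution powers -/

section LowerBound

/-- Each convolution enlarges the interval of positivity by ρ/2 on both sides: even for w near its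
edge, an interval of s of length ρ/2 keeps both s near b and w − s near a. -/
theorem lconvolution_lower_bound {f F : ℝ → ℝ≥0∞} {a b ρ R : ℝ} {α δ : ℝ≥0∞}
    (hρ : 0 < ρ) (hR : ρ ≤ R) (hf : ∀ s, |s - b| ≤ ρ → δ ≤ f s) (hF : ∀ s, |s - a| ≤ R → α ≤ F s)
    {w : ℝ} (hw : |w - (a + b)| ≤ R + ρ / 2) :
    α * (δ * ENNReal.ofReal (ρ / 2)) ≤ (f ⋆ₗ F) w := by
  obtain ⟨c, hc⟩ : ∃ c, ∀ s ∈ Set.Icc c (c + ρ / 2), |s - b| ≤ ρ ∧ |-s + w - a| ≤ R := by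
    -- The admissible s are taken in the outer half of the ρ-interval about b, on the side towards
    -- which w deviates from a + b.
    rw [abs_le] at hw
    rcases le_total (a + b) w with h | h
    · refine ⟨b + ρ / 2, fun s hs => ?_⟩
      obtain ⟨h1, h2⟩ := hs
      constructor <;> rw [abs_le] <;> constructor <;> linarith
    · refine ⟨b - ρ, fun s hs => ?_⟩
      obtain ⟨h1, h2⟩ := hs
      constructor <;> rw [abs_le] <;> constructor <;> linarith
  rw [lconvolution_def]
  calc α * (δ * ENNReal.ofReal (ρ / 2)) = ∫⁻ _ in Set.Icc c (c + ρ / 2), δ * α := by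
        rw [setLIntegral_const, Real.volume_Icc, add_sub_cancel_left]
        ring
    _ ≤ ∫⁻ s in Set.Icc c (c + ρ / 2), f s * F (-s + w) :=
        setLIntegral_mono' measurableSet_Icc fun s hs =>
          mul_le_mul' (hf s (hc s hs).1) (hF _ (hc s hs).2)
    _ ≤ ∫⁻ s, f s * F (-s + w) := setLIntegral_le_lintegral _ _

/-- A self-convolution is bounded below near `2x`, for some `x` in any set of positive measure on
which the function is positive. -/
theorem exists_lconvolution_self_lower_bound {h : ℝ → ℝ≥0∞} (hh : Measurable h) {E : Set ℝ}
    (hE : MeasurableSet E) (hpos : 0 < ∫⁻ s in E, h s) :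
    ∃ x ∈ E, ∃ ρ : ℝ, 0 < ρ ∧ ∃ δ : ℝ≥0∞, 0 < δ ∧
      ∀ w : ℝ, |w - 2 * x| ≤ ρ → δ ≤ (h ⋆ₗ h) w := by
  have h1 : ∃ n : ℕ, volume (E ∩ {s | ((n : ℝ≥0∞) + 1)⁻¹ < h s}) ≠ 0 := by
    by_contra! hcon
    have h2 : volume (⋃ n : ℕ, E ∩ {s | ((n : ℝ≥0∞) + 1)⁻¹ < h s}) = 0 :=
      measure_iUnion_null hcon
    refine hpos.ne' ?_
    rw [setLIntegral_eq_zero_iff hE hh]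
    filter_upwards [measure_eq_zero_iff_ae_notMem.1 h2] with s hs hsE
    by_contra hne
    refine hs (Set.mem_iUnion.2 ?_)
    obtain ⟨n, hn⟩ := ENNReal.exists_inv_nat_lt hne
    refine ⟨n, hsE, lt_of_le_of_lt ?_ hn⟩
    exact ENNReal.inv_le_inv.2 le_self_add
  obtain ⟨n, hn⟩ := h1
  set η := ((n : ℝ≥0∞) + 1)⁻¹ with hη
  have hη0 : 0 < η := by simp [hη]
  set D := E ∩ {s | η < h s} with hD
  have hDm : MeasurableSet D := hE.inter (measurableSet_lt measurable_const hh)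
  have hne : (ae (volume.restrict D)).NeBot := by
    rw [ae_neBot]
    simpa using hn
  -- At a Lebesgue density point x of a superlevel set, that set fills at least 3/4 of a small
  -- interval of radius r.
  obtain ⟨x, hx, hxD⟩ := ((Besicovitch.ae_tendsto_measure_inter_div volume D).and
    (ae_restrict_mem hDm)).exists
  obtain ⟨r, hr, hr0⟩ := ((hx.eventually_const_lt
    (show ENNReal.ofReal (3 / 4) < 1 by rw [← ENNReal.ofReal_one]; exact
      (ENNReal.ofReal_lt_ofReal_iff one_pos).2 (by norm_num))).and self_mem_nhdsWithin).exists
  have hr0 : 0 < r := hr0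
  set B := D ∩ Metric.closedBall x r with hB
  have hBm : MeasurableSet B := hDm.inter Metric.isClosed_closedBall.measurableSet
  have hBv : ENNReal.ofReal (3 / 2 * r) ≤ volume B := by
    rw [Real.volume_closedBall, ENNReal.lt_div_iff_mul_lt (by simp [hr0]) (by simp),
      ← ENNReal.ofReal_mul (by norm_num)] at hr
    refine le_trans (le_of_eq ?_) hr.le
    congr 1
    ring
  refine ⟨x, hxD.1, r / 2, by positivity, η * η * ENNReal.ofReal (r / 2), ?_, fun w hw => ?_⟩
  · have : 0 < ENNReal.ofReal (r / 2) := by simpa using hr0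
    exact ENNReal.mul_pos (ENNReal.mul_pos hη0.ne' hη0.ne').ne' this.ne'
  -- B and its reflection w − B each have measure at least 3r/2, but both lie in an interval of
  -- length 5r/2 when |w − 2x| ≤ r/2. They overlap in measure at least r/2, and there both factors
  -- exceed η.
  set B' := (fun s => w - s) ⁻¹' B with hB'
  have hB'm : MeasurableSet B' := hBm.preimage (by fun_prop)
  have hB'v : volume B' = volume B := by
    have := (Measure.measurePreserving_sub_left (volume : Measure ℝ) w)
    exact this.measure_preimage hBm.nullMeasurableSet
  have hunion : volume (B ∪ B') ≤ ENNReal.ofReal (5 / 2 * r) := by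
    rw [abs_le] at hw
    rcases le_total (2 * x) w with h | h
    · refine (measure_mono (t := Set.Icc (x - r) (x + 3 / 2 * r)) ?_).trans ?_
      · rintro s (hs | hs)
        · have := abs_le.1 (Real.norm_eq_abs _ ▸ mem_closedBall_iff_norm.1 hs.2)
          constructor <;> linarith
        · have := abs_le.1 (Real.norm_eq_abs _ ▸ mem_closedBall_iff_norm.1 hs.2)
          constructor <;> linarith
      · rw [Real.volume_Icc]
        exact ENNReal.ofReal_le_ofReal (by linarith)
    · refine (measure_mono (t := Set.Icc (x - 3 / 2 * r) (x + r)) ?_).trans ?_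
      · rintro s (hs | hs)
        · have := abs_le.1 (Real.norm_eq_abs _ ▸ mem_closedBall_iff_norm.1 hs.2)
          constructor <;> linarith
        · have := abs_le.1 (Real.norm_eq_abs _ ▸ mem_closedBall_iff_norm.1 hs.2)
          constructor <;> linarith
      · rw [Real.volume_Icc]
        exact ENNReal.ofReal_le_ofReal (by linarith)
  have hinter : ENNReal.ofReal (r / 2) ≤ volume (B ∩ B') := by
    have h2 := measure_union_add_inter (μ := volume) B hB'm
    rw [hB'v] at h2
    have h3 : ENNReal.ofReal (5 / 2 * r) + ENNReal.ofReal (r / 2) ≤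
        ENNReal.ofReal (5 / 2 * r) + volume (B ∩ B') := by
      rw [← ENNReal.ofReal_add (by positivity) (by positivity),
        show 5 / 2 * r + r / 2 = 3 / 2 * r + 3 / 2 * r by ring,
        ENNReal.ofReal_add (by positivity) (by positivity)]
      calc _ ≤ volume B + volume B := add_le_add hBv hBv
        _ = _ := h2.symm
        _ ≤ _ := add_le_add_left hunion _
    exact (ENNReal.add_le_add_iff_left ENNReal.ofReal_ne_top).1 h3
  rw [lconvolution_def]
  calc η * η * ENNReal.ofReal (r / 2) ≤ η * η * volume (B ∩ B') := by gcongr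
    _ = ∫⁻ _ in B ∩ B', η * η := by rw [setLIntegral_const]
    _ ≤ ∫⁻ s in B ∩ B', h s * h (-s + w) := by
        refine setLIntegral_mono' (hBm.inter hB'm) fun s hs => mul_le_mul' hs.1.1.2.le ?_
        rw [show -s + w = w - s by ring]
        exact hs.2.1.2.le
    _ ≤ ∫⁻ s, h s * h (-s + w) := setLIntegral_le_lintegral _ _

/-- Some convolution power is bounded below around the mean `n`, provided that the function charges
both sides of the mean `1`. -/
theorem exists_iterate_lconvolution_lower_bound {h : ℝ → ℝ≥0∞} (hh : Measurable h)
    (hlt : 0 < ∫⁻ s in Set.Iio 1, h s) (hgt : 0 < ∫⁻ s in Set.Ioi 1, h s) :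
    ∃ n : ℕ, ∃ ρ : ℝ, 0 < ρ ∧ ∃ δ : ℝ≥0∞, 0 < δ ∧
      ∀ w : ℝ, |w - (n + 1)| ≤ ρ → δ ≤ ((fun F => h ⋆ₗ F)^[n] h) w := by
  obtain ⟨x, hx, ρ₁, hρ₁, δ₁, hδ₁, hl₁⟩ :=
    exists_lconvolution_self_lower_bound hh measurableSet_Iio hlt
  obtain ⟨y, hy, ρ₂, hρ₂, δ₂, hδ₂, hl₂⟩ :=
    exists_lconvolution_self_lower_bound hh measurableSet_Ioi hgt
  set ρ := min ρ₁ ρ₂ with hρdef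
  have hρ : 0 < ρ := lt_min hρ₁ hρ₂
  have hx' : 0 < 1 - x := sub_pos.2 hx
  have hy' : 0 < y - 1 := sub_pos.2 hy
  have hlx : ∀ w : ℝ, |w - 2 * x| ≤ ρ → δ₁ ≤ (h ⋆ₗ h) w := fun w hw =>
    hl₁ w (hw.trans (min_le_left _ _))
  have hly : ∀ w : ℝ, |w - 2 * y| ≤ ρ → δ₂ ≤ (h ⋆ₗ h) w := fun w hw =>
    hl₂ w (hw.trans (min_le_right _ _))
  have hρE : 0 < ENNReal.ofReal (ρ / 2) := by simpa using hρ
  have hff : Measurable (h ⋆ₗ h) := measurable_lconvolution _ hh hh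
  have step : ∀ m : ℕ, (fun F => h ⋆ₗ F)^[m + 2] (h ⋆ₗ h) =
      (h ⋆ₗ h) ⋆ₗ ((fun F => h ⋆ₗ F)^[m] (h ⋆ₗ h)) := fun m => by
    rw [Function.iterate_succ_apply', Function.iterate_succ_apply']
    exact lconvolution_assoc hh hh (measurable_iterate_lconvolution hh hff m)
  have claim1 : ∀ p : ℕ, ∃ δ : ℝ≥0∞, 0 < δ ∧ ∀ w : ℝ, |w - 2 * x * (p + 1)| ≤ ρ + p * (ρ / 2) →
      δ ≤ ((fun F => h ⋆ₗ F)^[2 * p] (h ⋆ₗ h)) w := fun p => by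
    induction p with
    | zero => exact ⟨δ₁, hδ₁, fun w hw => hlx w (by simpa using hw)⟩
    | succ p ih =>
      obtain ⟨δ, hδ, hl⟩ := ih
      refine ⟨δ * (δ₁ * ENNReal.ofReal (ρ / 2)),
        ENNReal.mul_pos hδ.ne' (ENNReal.mul_pos hδ₁.ne' hρE.ne').ne', fun w hw => ?_⟩
      rw [show 2 * (p + 1) = 2 * p + 2 by ring, step]
      refine lconvolution_lower_bound hρ (le_add_of_nonneg_right (by positivity)) hlx hl ?_
      push_cast at hw
      rw [show 2 * x * (p + 1) + 2 * x = 2 * x * (p + 1 + 1) by ring]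
      linarith
  have claim2 : ∀ p q : ℕ, ∃ δ : ℝ≥0∞, 0 < δ ∧ ∀ w : ℝ,
      |w - (2 * x * (p + 1) + 2 * y * q)| ≤ ρ + (p + q) * (ρ / 2) →
      δ ≤ ((fun F => h ⋆ₗ F)^[2 * (p + q)] (h ⋆ₗ h)) w := fun p q => by
    induction q with
    | zero => simpa using claim1 p
    | succ q ih =>
      obtain ⟨δ, hδ, hl⟩ := ih
      refine ⟨δ * (δ₂ * ENNReal.ofReal (ρ / 2)),
        ENNReal.mul_pos hδ.ne' (ENNReal.mul_pos hδ₂.ne' hρE.ne').ne', fun w hw => ?_⟩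
      rw [show 2 * (p + (q + 1)) = 2 * (p + q) + 2 by ring, step]
      refine lconvolution_lower_bound hρ (le_add_of_nonneg_right (by positivity)) hly hl ?_
      push_cast at hw
      rw [show 2 * x * (p + 1) + 2 * y * q + 2 * y = 2 * x * (p + 1) + 2 * y * (q + 1) by ring]
      linarith
  -- The numbers p, q are chosen with p a ≈ q b, so that p points 2x and q points 2y balance around
  -- the mean. Rounding and the extra point 2x cost at most 4(a + b), and t is large enough for the
  -- gained radius qρ/2 to absorb this.
  set a := 1 - x with ha
  set b := y - 1 with hb
  set t := (8 * (a + b) / ρ + 1) / a with ht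
  have ht0 : 0 ≤ t := by positivity
  set p := ⌊t * b⌋₊ with hp
  set q := ⌊t * a⌋₊ with hq
  have hp1 : (p : ℝ) ≤ t * b := Nat.floor_le (by positivity)
  have hp2 : t * b < p + 1 := Nat.lt_floor_add_one _
  have hq1 : (q : ℝ) ≤ t * a := Nat.floor_le (by positivity)
  have hq2 : t * a < q + 1 := Nat.lt_floor_add_one _
  obtain ⟨δ, hδ, hl⟩ := claim2 p q
  -- There are p + q + 1 copies of h ⋆ h, that is 2(p + q) + 2 factors h, which is this index plus
  -- one.
  refine ⟨2 * (p + q) + 1, ρ, hρ, δ, hδ, fun w hw => ?_⟩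
  rw [Function.iterate_succ_apply]
  refine hl w ?_
  have hqρ : 4 * (a + b) ≤ q * (ρ / 2) := by
    have h1 : t * a = 8 * (a + b) / ρ + 1 := by
      rw [ht]
      field_simp
    have h2 : 8 * (a + b) / ρ ≤ q := by linarith
    rw [div_le_iff₀ hρ] at h2
    linarith
  have hpρ : 0 ≤ p * (ρ / 2) := by positivity
  have e1 : |(p : ℝ) * a - q * b| ≤ a + b := by
    rw [abs_le]
    constructor <;> nlinarith
  have e2 : w - (2 * x * (p + 1) + 2 * y * q) =
      (w - (((2 * (p + q) + 1 : ℕ) : ℝ) + 1)) + 2 * a + 2 * (p * a - q * b) := by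
    push_cast
    rw [ha, hb]
    ring
  rw [e2]
  have e3 := abs_add_le ((w - (((2 * (p + q) + 1 : ℕ) : ℝ) + 1)) + 2 * a) (2 * (p * a - q * b))
  have e4 := abs_add_le (w - (((2 * (p + q) + 1 : ℕ) : ℝ) + 1)) (2 * a)
  rw [abs_mul, abs_two] at e3
  rw [abs_of_pos (show 0 < 2 * a by linarith)] at e4
  linarith

/-- Exponential lower bound for high convolution powers. -/
theorem iterate_lconvolution_lower_bound {h : ℝ → ℝ≥0∞} (hh : Measurable h) {n : ℕ} {ρ : ℝ}
    (hρ : 0 < ρ) {δ : ℝ≥0∞}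
    (hl : ∀ w : ℝ, |w - (n + 1)| ≤ ρ → δ ≤ ((fun F => h ⋆ₗ F)^[n] h) w) (j : ℕ) :
    ∀ w : ℝ, |w - (n + 1) * (j + 1)| ≤ (j + 1) * (ρ / 2) →
      δ * (δ * ENNReal.ofReal (ρ / 2)) ^ j ≤ ((fun F => h ⋆ₗ F)^[(n + 1) * j + n] h) w := by
  have key : ∀ w : ℝ, |w - (n + 1) * (j + 1)| ≤ ρ + j * (ρ / 2) →
      δ * (δ * ENNReal.ofReal (ρ / 2)) ^ j ≤ ((fun F => h ⋆ₗ F)^[(n + 1) * j + n] h) w := by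
    induction j with
    | zero => simpa using hl
    | succ j ih =>
      intro w hw
      have e : (fun F => h ⋆ₗ F)^[(n + 1) * (j + 1) + n] h =
          ((fun F => h ⋆ₗ F)^[n] h) ⋆ₗ ((fun F => h ⋆ₗ F)^[(n + 1) * j + n] h) := by
        rw [← iterate_succ_lconvolution hh (measurable_iterate_lconvolution hh hh _),
          ← Function.iterate_add_apply,
          show (n + 1) * (j + 1) + n = n + 1 + ((n + 1) * j + n) by ring]
      rw [e, pow_succ, ← mul_assoc]
      refine lconvolution_lower_bound hρ (le_add_of_nonneg_right (by positivity)) hl ih ?_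
      push_cast at hw
      rw [show ((n : ℝ) + 1) * (j + 1) + (n + 1) = (n + 1) * (j + 1 + 1) by ring]
      linarith
  intro w hw
  exact key w (by linarith)

end LowerBound

/-! ### Subexponential lower bound for the partition function -/

section PartitionFunction

variable {g : ℝ → ℝ}

theorem integrable_densityMeasure_iff (hg : Measurable g) (hg0 : ∀ x, 0 ≤ g x) {f : ℝ → ℝ} :
    Integrable f (densityMeasure g) ↔ Integrable fun x => g x * f x := by
  rw [densityMeasure, integrable_withDensity_iff (by fun_prop) (Eventually.of_forall fun x => by simp)]
  simp_rw [ENNReal.toReal_ofReal (hg0 _), mul_comm]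

theorem integral_densityMeasure (hg : Measurable g) (hg0 : ∀ x, 0 ≤ g x) (f : ℝ → ℝ) :
    ∫ x, f x ∂(densityMeasure g) = ∫ x, g x * f x := by
  rw [densityMeasure, integral_withDensity_eq_integral_toReal_smul (by fun_prop)
    (Eventually.of_forall fun x => by simp)]
  simp_rw [ENNReal.toReal_ofReal (hg0 _), smul_eq_mul]

theorem memLp_sq_densityMeasure (hg : Measurable g) (hg0 : ∀ x, 0 ≤ g x)
    (h4 : Integrable fun x => g x * x ^ 4) :
    MemLp (fun v : ℝ => v ^ 2) 2 (densityMeasure g) := by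
  rw [memLp_two_iff_integrable_sq (by fun_prop), integrable_densityMeasure_iff hg hg0]
  simpa [← pow_mul] using h4

theorem densityMeasure_sq_eq_one : densityMeasure g {v | v ^ 2 = 1} = 0 := by
  refine withDensity_absolutelyContinuous _ _ ?_
  have : {v : ℝ | v ^ 2 = 1} ⊆ {1, -1} := fun v hv => by
    rcases sq_eq_sq_iff_eq_or_eq_neg.1 (show v ^ 2 = 1 ^ 2 by rw [hv.out, one_pow]) with h | h <;>
      simp [h]
  exact measure_mono_null this ((Set.toFinite _).measure_zero _)

/-- Otherwise f would be nonnegative with zero mean, hence zero a.e., and ν would be carried by {1,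
−1}; it has a density. -/
theorem densityMeasure_pos_of_integral_eq_zero [IsProbabilityMeasure (densityMeasure g)]
    {f : ℝ → ℝ} (hf : Integrable f (densityMeasure g)) (h0 : ∫ v, f v ∂(densityMeasure g) = 0)
    (hne : ∀ v, f v = 0 → v ^ 2 = 1) : 0 < densityMeasure g {v | f v < 0} := by
  rw [pos_iff_ne_zero]
  intro hz
  have hnn : 0 ≤ᵐ[densityMeasure g] f := by
    filter_upwards [measure_eq_zero_iff_ae_notMem.1 hz] with v hv
    exact not_lt.1 hv
  have h1 := (integral_eq_zero_iff_of_nonneg_ae hnn hf).1 h0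
  have h2 : ∀ᵐ v ∂(densityMeasure g), False := by
    filter_upwards [h1, measure_eq_zero_iff_ae_notMem.1 (densityMeasure_sq_eq_one (g := g))]
      with v hv hv2
    exact hv2 (hne v hv)
  rw [ae_iff] at h2
  simp at h2

theorem setLIntegral_sqDensity_pos (hg : Measurable g) (hg0 : ∀ x, 0 ≤ g x)
    [IsProbabilityMeasure (densityMeasure g)] (h2 : ∫ x, g x * x ^ 2 = 1)
    (h4 : Integrable fun x => g x * x ^ 4) :
    0 < ∫⁻ s in Set.Iio 1, sqDensity g s ∧ 0 < ∫⁻ s in Set.Ioi 1, sqDensity g s := by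
  have hi : Integrable (fun v : ℝ => v ^ 2) (densityMeasure g) :=
    (memLp_sq_densityMeasure hg hg0 h4).integrable one_le_two
  have h2' : ∫ v, v ^ 2 ∂(densityMeasure g) = 1 := by
    rw [integral_densityMeasure hg hg0, h2]
  have key : ∀ A : Set ℝ, MeasurableSet A → densityMeasure g {v | 1 - v ^ 2 ∈ A} =
      ∫⁻ s in {s | 1 - s ∈ A}, sqDensity g s := fun A hA => by
    have h := lintegral_comp_sub_sq hg (measurable_one.indicator hA) 1
    rw [lconvolution_def] at h
    have hm : MeasurableSet {v : ℝ | 1 - v ^ 2 ∈ A} := hA.preimage (by fun_prop)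
    have hm' : MeasurableSet {s : ℝ | 1 - s ∈ A} := hA.preimage (by fun_prop)
    calc densityMeasure g {v | 1 - v ^ 2 ∈ A} = ∫⁻ v, A.indicator 1 (1 - v ^ 2) ∂(densityMeasure g) := by
          rw [← lintegral_indicator_one hm]
          rfl
      _ = _ := h
      _ = _ := by
          rw [← lintegral_indicator hm']
          refine lintegral_congr fun s => ?_
          rw [show -s + 1 = 1 - s by ring]
          by_cases hs : 1 - s ∈ A
          · rw [Set.indicator_of_mem hs, Set.indicator_of_mem (show s ∈ {s | 1 - s ∈ A} from hs)]
            simp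
          · rw [Set.indicator_of_notMem hs,
              Set.indicator_of_notMem (show s ∉ {s | 1 - s ∈ A} from hs), mul_zero]
  have e1 : Integrable (fun v : ℝ => v ^ 2 - 1) (densityMeasure g) := hi.sub (integrable_const 1)
  have e2 : ∫ v, (v ^ 2 - 1) ∂(densityMeasure g) = 0 := by
    rw [integral_sub hi (integrable_const 1), h2']
    simp
  have e3 : Integrable (fun v : ℝ => 1 - v ^ 2) (densityMeasure g) := (integrable_const 1).sub hi
  have e4 : ∫ v, (1 - v ^ 2) ∂(densityMeasure g) = 0 := by
    rw [integral_sub (integrable_const 1) hi, h2']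
    simp
  constructor
  · have h := densityMeasure_pos_of_integral_eq_zero e1 e2 fun v hv => sub_eq_zero.1 hv
    have h3 := key (Set.Ioi 0) measurableSet_Ioi
    have r1 : {v : ℝ | 1 - v ^ 2 ∈ Set.Ioi 0} = {v | v ^ 2 - 1 < 0} := by ext; simp
    have r2 : {s : ℝ | 1 - s ∈ Set.Ioi 0} = Set.Iio 1 := by ext; simp
    rw [r1, r2] at h3
    rwa [h3] at h
  · have h := densityMeasure_pos_of_integral_eq_zero e3 e4 fun v hv => (sub_eq_zero.1 hv).symm
    have h3 := key (Set.Iio 0) measurableSet_Iio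
    have r2 : {s : ℝ | 1 - s ∈ Set.Iio 0} = Set.Ioi 1 := by ext; simp
    rw [r2] at h3
    exact h3 ▸ h

/-- Chebyshev's inequality for the energy of `n` independent velocities. -/
theorem half_le_pi_abs_sqSum_sub_le (hg : Measurable g) (hg0 : ∀ x, 0 ≤ g x)
    [IsProbabilityMeasure (densityMeasure g)] (h2 : ∫ x, g x * x ^ 2 = 1)
    (h4 : Integrable fun x => g x * x ^ 4) (n : ℕ) {r : ℝ} (hr : 0 < r)
    (hnr : 2 * (n * Var[fun v => v ^ 2; densityMeasure g]) ≤ r ^ 2) :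
    2⁻¹ ≤ Measure.pi (fun _ : Fin n => densityMeasure g) {y | |sqSum y - n| ≤ r} := by
  have hX := memLp_sq_densityMeasure hg hg0 h4
  set P := Measure.pi (fun _ : Fin n => densityMeasure g) with hP
  have hsum : (sqSum : (Fin n → ℝ) → ℝ) = ∑ i : Fin n, fun y => (fun v : ℝ => v ^ 2) (y i) := by
    ext y
    simp [sqSum]
  have hcoord : ∀ i : Fin n, MemLp (fun y : Fin n → ℝ => y i ^ 2) 2 P := fun i =>
    hX.comp_measurePreserving (measurePreserving_eval (fun _ => densityMeasure g) i)
  have hmem : MemLp (sqSum : (Fin n → ℝ) → ℝ) 2 P := by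
    rw [hsum]
    exact memLp_finsetSum' _ fun i _ => hcoord i
  have hvar : Var[sqSum; P] = n * Var[fun v => v ^ 2; densityMeasure g] := by
    rw [hsum, hP, variance_sum_pi fun _ => hX]
    simp
  have hmean : ∫ y, sqSum y ∂P = n := by
    simp only [sqSum]
    rw [integral_finsetSum _ fun i _ => (hcoord i).integrable one_le_two]
    have : ∀ i : Fin n, ∫ y : Fin n → ℝ, y i ^ 2 ∂P = 1 := fun i => by
      have := integral_comp_eval (μ := fun _ : Fin n => densityMeasure g) (i := i)
        (f := fun v : ℝ => v ^ 2) (by fun_prop)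
      rw [hP, this, integral_densityMeasure hg hg0, h2]
    simp [this]
  have hch := meas_ge_le_variance_div_sq hmem hr
  rw [hvar, hmean] at hch
  have hle : n * Var[fun v => v ^ 2; densityMeasure g] / r ^ 2 ≤ 2⁻¹ := by
    rw [div_le_iff₀ (by positivity)]
    linarith
  have hch2 : P {y | r ≤ |sqSum y - n|} ≤ 2⁻¹ := by
    refine hch.trans ((ENNReal.ofReal_le_ofReal hle).trans ?_)
    rw [ENNReal.ofReal_inv_of_pos two_pos, ENNReal.ofReal_ofNat]
  have hm : MeasurableSet {y : Fin n → ℝ | |sqSum y - n| ≤ r} :=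
    measurableSet_le (by fun_prop) measurable_const
  have hc : P {y | |sqSum y - n| ≤ r}ᶜ ≤ 2⁻¹ := by
    refine (measure_mono fun y hy => ?_).trans hch2
    have hy : ¬ |sqSum y - n| ≤ r := hy
    exact (not_le.1 hy).le
  have h1 : 1 ≤ P {y | |sqSum y - n| ≤ r} + 2⁻¹ := by
    rw [← prob_add_prob_compl hm (μ := P)]
    gcongr
  refine (ENNReal.add_le_add_iff_right (a := 2⁻¹) (by simp)).1 ?_
  rwa [ENNReal.inv_two_add_inv_two]

theorem exists_ofReal_exp_neg_le {m : ℝ≥0∞} (hm : 0 < m) :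
    ∃ A : ℝ, 0 < A ∧ ENNReal.ofReal (Real.exp (-A)) ≤ m := by
  obtain ⟨r, hr0, hr⟩ : ∃ r : ℝ, 0 < r ∧ ENNReal.ofReal r ≤ m := by
    refine ⟨(min m 1).toReal, ENNReal.toReal_pos (lt_min hm one_pos).ne' (by simp), ?_⟩
    rw [ENNReal.ofReal_toReal (by simp)]
    exact min_le_left _ _
  refine ⟨max 1 (-Real.log r), by positivity, (ENNReal.ofReal_le_ofReal ?_).trans hr⟩
  rw [← Real.le_log_iff_exp_le hr0]
  linarith [le_max_right 1 (-Real.log r)]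

/-- The density of the energy at its mean decays subexponentially. -/
theorem eventually_le_iterate_lconvolution (hg : Measurable g) (hg0 : ∀ x, 0 ≤ g x)
    (h1 : ∫ x, g x = 1) (h2 : ∫ x, g x * x ^ 2 = 1) (h4 : Integrable fun x => g x * x ^ 4)
    {ε : ℝ} (hε : 0 < ε) :
    ∀ᶠ n : ℕ in atTop, ENNReal.ofReal (Real.exp (-(ε * n))) ≤
      ((fun F => sqDensity g ⋆ₗ F)^[n] (sqDensity g)) (n + 1) := by
  have := isProbabilityMeasure_densityMeasure hg0 h1
  have hh := measurable_sqDensity hg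
  obtain ⟨hlt, hgt⟩ := setLIntegral_sqDensity_pos hg hg0 h2 h4
  obtain ⟨m, ρ, hρ, δ, hδ, hl⟩ := exists_iterate_lconvolution_lower_bound hh hlt hgt
  have hl' := iterate_lconvolution_lower_bound hh hρ hl
  set κ := δ * ENNReal.ofReal (ρ / 2) with hκ
  have hκ0 : 0 < κ := ENNReal.mul_pos hδ.ne' (by simpa using hρ)
  obtain ⟨A, hA, hAm⟩ := exists_ofReal_exp_neg_le (lt_min hδ hκ0)
  have hpow : ∀ j : ℕ, ENNReal.ofReal (Real.exp (-(A * (j + 1)))) ≤ δ * κ ^ j := fun j => by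
    have : Real.exp (-(A * (j + 1))) = Real.exp (-A) * Real.exp (-A) ^ j := by
      rw [← Real.exp_nat_mul, ← Real.exp_add]
      ring_nf
    rw [this, ENNReal.ofReal_mul (Real.exp_pos _).le, ENNReal.ofReal_pow (Real.exp_pos _).le]
    exact mul_le_mul' (hAm.trans (min_le_left _ _))
      (pow_le_pow_left' (hAm.trans (min_le_right _ _)) j)
  set V := Var[fun v => v ^ 2; densityMeasure g] with hV
  have hV0 : 0 ≤ V := variance_nonneg _ _
  -- The first cap keeps the loss A(j + 1) below εn/2; the second ensures that (j + 1) groups of m +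
  -- 1 particles fit among n.
  set η := min (ε / (2 * A)) (1 / (m + 1)) with hη
  have hη0 : 0 < η := lt_min (by positivity) (by positivity)
  -- The three thresholds give in turn j + 1 ≥ ηn/2, the variance condition for Chebyshev, and
  -- e^{−εn/2} ≤ 1/2.
  filter_upwards [eventually_ge_atTop (⌈2 / η⌉₊ + ⌈64 * V / (η ^ 2 * ρ ^ 2)⌉₊ + ⌈2 / ε⌉₊ + 1)]
    with n hn
  have hn' : ((⌈2 / η⌉₊ : ℝ) + ⌈64 * V / (η ^ 2 * ρ ^ 2)⌉₊ + ⌈2 / ε⌉₊ + 1) ≤ n := by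
    exact_mod_cast hn
  have p1 := Nat.le_ceil (2 / η)
  have p2 := Nat.le_ceil (64 * V / (η ^ 2 * ρ ^ 2))
  have p3 := Nat.le_ceil (2 / ε)
  have q1 : (0 : ℝ) ≤ ⌈2 / η⌉₊ := Nat.cast_nonneg _
  have q2 : (0 : ℝ) ≤ ⌈64 * V / (η ^ 2 * ρ ^ 2)⌉₊ := Nat.cast_nonneg _
  have q3 : (0 : ℝ) ≤ ⌈2 / ε⌉₊ := Nat.cast_nonneg _
  have n1 : 2 ≤ n * η := (div_le_iff₀ hη0).1 (by linarith)
  have n2 : 64 * V ≤ n * (η ^ 2 * ρ ^ 2) := (div_le_iff₀ (by positivity)).1 (by linarith)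
  have n3 : 2 ≤ n * ε := (div_le_iff₀ hε).1 (by linarith)
  have n4 : (1 : ℝ) ≤ n := by linarith
  obtain ⟨j, hj⟩ : ∃ j, ⌊η * n⌋₊ = j + 1 := by
    refine Nat.exists_eq_succ_of_ne_zero (Nat.floor_pos.2 ?_).ne'
    linarith
  have hJ1 : (j : ℝ) + 1 ≤ η * n := by
    have := Nat.floor_le (show 0 ≤ η * n by positivity)
    rw [hj] at this
    exact_mod_cast this
  have hJ2 : η * n < j + 1 + 1 := by
    have := Nat.lt_floor_add_one (η * n)
    rw [hj] at this
    exact_mod_cast this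
  have hle : (m + 1) * (j + 1) ≤ n := by
    have h5 : (m + 1) * ((j : ℝ) + 1) ≤ n := by
      calc (m + 1) * ((j : ℝ) + 1) ≤ (m + 1) * (η * n) := by gcongr
        _ ≤ (m + 1) * (1 / (m + 1) * n) := by
            gcongr
            exact min_le_right _ _
        _ = n := by field_simp
    exact_mod_cast h5
  -- The n + 1 factors split into (m + 1)(j + 1) that provide the wide density bound and M whose
  -- energy is only controlled by Chebyshev.
  obtain ⟨M, hM⟩ : ∃ M, n + 1 = M + (m + 1) * (j + 1) := ⟨n + 1 - (m + 1) * (j + 1), by omega⟩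
  have hn_eq : n = M + ((m + 1) * j + m) := by
    have : (m + 1) * (j + 1) = (m + 1) * j + m + 1 := by ring
    omega
  have hMn : (M : ℝ) ≤ 2 * n := by
    have h6 : (M : ℝ) ≤ n + 1 := by exact_mod_cast (by omega : M ≤ n + 1)
    linarith
  set r := ((j : ℝ) + 1) * (ρ / 2) with hr
  have hr0 : 0 < r := by positivity
  have hrη : η * n * ρ / 4 ≤ r := by
    rw [hr]
    nlinarith
  have hprob := half_le_pi_abs_sqSum_sub_le hg hg0 h2 h4 M hr0 (by
    calc 2 * (M * V) ≤ 2 * (2 * n * V) := by gcongr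
      _ ≤ (η * n * ρ / 4) ^ 2 := by nlinarith
      _ ≤ r ^ 2 := pow_le_pow_left₀ (by positivity) hrη 2)
  have hexp : Real.exp (-(ε * n)) ≤ Real.exp (-(A * (j + 1))) * 2⁻¹ := by
    have h5 : A * (j + 1) ≤ ε * n / 2 := by
      calc A * (j + 1) ≤ A * (η * n) := by gcongr
        _ ≤ A * (ε / (2 * A) * n) := by
            gcongr
            exact min_le_left _ _
        _ = ε * n / 2 := by field_simp
    have h6 : Real.exp (-(ε * n)) = Real.exp (-(ε * n / 2)) * Real.exp (-(ε * n / 2)) := by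
      rw [← Real.exp_add]
      ring_nf
    rw [h6]
    refine mul_le_mul (Real.exp_le_exp.2 (by linarith)) ?_ (Real.exp_pos _).le (Real.exp_pos _).le
    rw [Real.exp_neg]
    refine inv_anti₀ two_pos ?_
    have := Real.add_one_le_exp (ε * n / 2)
    linarith
  have hcast : (n : ℝ) + 1 = M + (m + 1) * (j + 1) := by exact_mod_cast hM
  have hm : MeasurableSet {y : Fin M → ℝ | |sqSum y - M| ≤ r} :=
    measurableSet_le (by fun_prop) measurable_const
  have hiter : (fun F => sqDensity g ⋆ₗ F)^[n] (sqDensity g) = (fun F => sqDensity g ⋆ₗ F)^[M]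
      ((fun F => sqDensity g ⋆ₗ F)^[(m + 1) * j + m] (sqDensity g)) := by
    rw [← Function.iterate_add_apply, ← hn_eq]
  rw [hiter, ← lintegral_pi_comp_sub_sqSum hg
    (measurable_iterate_lconvolution hh hh _)]
  calc ENNReal.ofReal (Real.exp (-(ε * n)))
      ≤ ENNReal.ofReal (Real.exp (-(A * (j + 1)))) * 2⁻¹ := by
        refine (ENNReal.ofReal_le_ofReal hexp).trans ?_
        rw [ENNReal.ofReal_mul (Real.exp_pos _).le, ENNReal.ofReal_inv_of_pos two_pos,
          ENNReal.ofReal_ofNat]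
    _ ≤ δ * κ ^ j * Measure.pi (fun _ : Fin M => densityMeasure g) {y | |sqSum y - M| ≤ r} :=
        mul_le_mul' (hpow j) hprob
    _ = ∫⁻ _ in {y | |sqSum y - M| ≤ r}, δ * κ ^ j ∂(Measure.pi fun _ : Fin M => densityMeasure g) := by
        rw [setLIntegral_const]
    _ ≤ ∫⁻ y in {y | |sqSum y - M| ≤ r}, ((fun F => sqDensity g ⋆ₗ F)^[(m + 1) * j + m]
          (sqDensity g)) (n + 1 - sqSum y) ∂(Measure.pi fun _ : Fin M => densityMeasure g) := by
        refine setLIntegral_mono' hm fun y hy => hl' j _ ?_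
        have hy : |sqSum y - M| ≤ r := hy
        rw [hcast, show (M : ℝ) + (m + 1) * (j + 1) - sqSum y - (m + 1) * (j + 1) =
          -(sqSum y - M) by ring, abs_neg]
        exact hy
    _ ≤ _ := setLIntegral_le_lintegral _ _

theorem eventually_sliceConst_mul_exp_le_Z (hg : Measurable g) (hg0 : ∀ x, 0 ≤ g x)
    (h1 : ∫ x, g x = 1) (h2 : ∫ x, g x * x ^ 2 = 1) (h4 : Integrable fun x => g x * x ^ 4)
    {ε : ℝ} (hε : 0 < ε) :
    ∀ᶠ n : ℕ in atTop, sliceConst n * ENNReal.ofReal (Real.exp (-(ε * n))) ≤ Z g (n + 1) := by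
  have := isProbabilityMeasure_densityMeasure hg0 h1
  filter_upwards [eventually_le_iterate_lconvolution hg hg0 h1 h2 h4 hε] with n hn
  exact (mul_le_mul_right hn _).trans (le_Z hg n)

end PartitionFunction

/-! ### Independence of disjoint blocks -/

section Blocks

/-- Integration of a product over disjoint blocks of coordinates. -/
theorem lintegral_prod_blocks {N M k : ℕ} (lam : Fin N → Measure ℝ) [∀ j, IsProbabilityMeasure (lam j)]
    (ν : Measure ℝ) [IsProbabilityMeasure ν] {e : Fin M × Fin k → Fin N}
    (he : Function.Injective e) (hlam : ∀ p, lam (e p) = ν) {F : (Fin k → ℝ) → ℝ≥0∞}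
    (hF : Measurable F) :
    ∫⁻ x, ∏ l, F (fun i => x (e (l, i))) ∂(Measure.pi lam) =
      (∫⁻ y, F y ∂(Measure.pi fun _ => ν)) ^ M := by
  have hind : iIndepFun (fun (j : Fin N) (x : Fin N → ℝ) => x j) (Measure.pi lam) :=
    iIndepFun_pi (X := fun _ => id) fun _ => aemeasurable_id
  have hmap : (Measure.pi lam).map (fun x p => x (e p)) =
      Measure.pi fun _ : Fin M × Fin k => ν := by
    rw [(iIndepFun_iff_map_fun_eq_pi_map fun p => (measurable_pi_apply (e p)).aemeasurable).1
      (hind.precomp he)]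
    congr 1
    ext1 p
    rw [← hlam p]
    exact (measurePreserving_eval lam (e p)).map_eq
  have hcurry : (Measure.pi fun _ : Fin M => Measure.pi fun _ : Fin k => ν).map
      (fun z (p : Fin M × Fin k) => z p.1 p.2) = Measure.pi fun _ : Fin M × Fin k => ν := by
    refine (Measure.pi_eq fun s hs => ?_).symm
    rw [Measure.map_apply (by fun_prop) (MeasurableSet.univ_pi hs)]
    have : (fun (z : Fin M → Fin k → ℝ) (p : Fin M × Fin k) => z p.1 p.2) ⁻¹' Set.univ.pi s =
        Set.univ.pi fun l => Set.univ.pi fun i => s (l, i) := by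
      ext z
      simp [Set.mem_pi]
    rw [this, Measure.pi_pi]
    simp_rw [Measure.pi_pi]
    rw [Fintype.prod_prod_type]
  have hm : Measurable fun z : Fin M × Fin k → ℝ => ∏ l, F fun i => z (l, i) :=
    Finset.measurable_fun_prod _ fun l _ => hF.comp (by fun_prop)
  calc ∫⁻ x, ∏ l, F (fun i => x (e (l, i))) ∂(Measure.pi lam)
      = ∫⁻ z, ∏ l, F (fun i => z (l, i)) ∂((Measure.pi lam).map fun x p => x (e p)) := by
        rw [lintegral_map hm (by fun_prop)]
    _ = ∫⁻ z : Fin M → Fin k → ℝ, ∏ l, F (z l) ∂(Measure.pi fun _ => Measure.pi fun _ => ν) := by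
        rw [hmap, ← hcurry, lintegral_map hm (by fun_prop)]
    _ = _ := by
        rw [lintegral_prod_pi _ fun _ => hF]
        simp

end Blocks

/-! ### Integrable weights that absorb the singularity at v_i = 0 -/

section Weight

variable {g : ℝ → ℝ}

/-- The density `g^q |t|^{1-q}`. -/
noncomputable def weight (g : ℝ → ℝ) (q : ℝ) (t : ℝ) : ℝ≥0∞ :=
  ENNReal.ofReal |t| * (ENNReal.ofReal (g t) / ENNReal.ofReal |t|) ^ q

theorem measurable_weight (hg : Measurable g) (q : ℝ) : Measurable (weight g q) := by
  unfold weight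
  fun_prop

/-- The left side is A^q s^{1−q}. For s < 1, compare A with s^{−1/2}: a larger A absorbs s^{1−q} and
leaves A^{3q−2}, a smaller one leaves s^{1−3q/2}. For s ≥ 1 the power of s is at most 1. -/
theorem mul_div_rpow_le {A s p q : ℝ} (hA : 0 ≤ A) (hs : 0 < s) (hq : 1 ≤ q) (hpq : 3 * q - 2 ≤ p) :
    s * (A / s) ^ q ≤ A + A ^ p + (Set.Iio 1).indicator (fun s => s ^ (1 - 3 * q / 2)) s := by
  have hAp : 0 ≤ A ^ p := Real.rpow_nonneg hA p
  have e : s * (A / s) ^ q = A ^ q * s ^ (1 - q) := by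
    rw [Real.div_rpow hA hs.le, Real.rpow_sub hs, Real.rpow_one]
    ring
  rw [e]
  rcases lt_or_ge s 1 with h | h
  · rw [Set.indicator_of_mem (show s ∈ Set.Iio 1 from h)]
    have hr : 0 ≤ s ^ (1 - 3 * q / 2) := Real.rpow_nonneg hs.le _
    rcases le_total (s ^ (-(1 / 2) : ℝ)) A with h1 | h1
    · have hs1 : 1 ≤ s ^ (-(1 / 2) : ℝ) := Real.one_le_rpow_of_pos_of_le_one_of_nonpos hs h.le
        (by norm_num)
      have hA1 : 1 ≤ A := hs1.trans h1
      have h2 : s ^ (1 - q) ≤ A ^ (2 * (q - 1)) := by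
        have : s ^ (1 - q) = (s ^ (-(1 / 2) : ℝ)) ^ (2 * (q - 1)) := by
          rw [← Real.rpow_mul hs.le]
          congr 1
          ring
        rw [this]
        exact Real.rpow_le_rpow (by positivity) h1 (by linarith)
      have h3 : A ^ q * s ^ (1 - q) ≤ A ^ p := by
        calc A ^ q * s ^ (1 - q) ≤ A ^ q * A ^ (2 * (q - 1)) := by gcongr
          _ = A ^ (3 * q - 2) := by
              rw [← Real.rpow_add (by linarith)]
              congr 1
              ring
          _ ≤ A ^ p := Real.rpow_le_rpow_of_exponent_le hA1 hpq
      linarith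
    · have h3 : A ^ q * s ^ (1 - q) ≤ s ^ (1 - 3 * q / 2) := by
        calc A ^ q * s ^ (1 - q) ≤ (s ^ (-(1 / 2) : ℝ)) ^ q * s ^ (1 - q) := by gcongr
          _ = s ^ (1 - 3 * q / 2) := by
              rw [← Real.rpow_mul hs.le, ← Real.rpow_add hs]
              congr 1
              ring
      linarith
  · rw [Set.indicator_of_notMem (show s ∉ Set.Iio 1 from h.not_gt), add_zero]
    have h1 : s ^ (1 - q) ≤ 1 := Real.rpow_le_one_of_one_le_of_nonpos h (by linarith)
    have h2 : A ^ q ≤ A + A ^ p := by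
      rcases le_total A 1 with hA1 | hA1
      · have : A ^ q ≤ A ^ (1 : ℝ) := Real.rpow_le_rpow_of_exponent_ge' hA hA1 zero_le_one hq
        rw [Real.rpow_one] at this
        linarith
      · have : A ^ q ≤ A ^ p := Real.rpow_le_rpow_of_exponent_le hA1 (by linarith)
        linarith
    calc A ^ q * s ^ (1 - q) ≤ A ^ q * 1 := by
          gcongr
      _ ≤ _ := by linarith

theorem lintegral_abs_rpow_ne_top {r : ℝ} (hr : -1 < r) :
    ∫⁻ t : ℝ, ENNReal.ofReal ((Set.Iio 1).indicator (fun s => s ^ r) |t|) ≠ ∞ := by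
  set f : ℝ → ℝ≥0∞ := fun t => ENNReal.ofReal ((Set.Iio 1).indicator (fun s => s ^ r) |t|) with hf
  have hpos : ∫⁻ t in Set.Ioi 0, f t ≠ ∞ := by
    have hi : IntegrableOn (fun s : ℝ => s ^ r) (Set.Ioo 0 1) :=
      (intervalIntegral.integrableOn_Ioo_rpow_iff one_pos).2 hr
    have := hi.lintegral_lt_top
    refine ne_top_of_le_ne_top this.ne ?_
    rw [← lintegral_indicator measurableSet_Ioi, ← lintegral_indicator measurableSet_Ioo]
    refine lintegral_mono fun t => ?_
    by_cases h : 0 < t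
    · rw [Set.indicator_of_mem (show t ∈ Set.Ioi 0 from h)]
      simp only [hf, abs_of_pos h]
      by_cases h1 : t < 1
      · rw [Set.indicator_of_mem (show t ∈ Set.Iio 1 from h1),
          Set.indicator_of_mem (show t ∈ Set.Ioo 0 1 from ⟨h, h1⟩)]
      · rw [Set.indicator_of_notMem (show t ∉ Set.Iio 1 from h1)]
        simp
    · rw [Set.indicator_of_notMem (show t ∉ Set.Ioi 0 from h)]
      exact bot_le
  have hneg : ∫⁻ t in Set.Iio 0, f t = ∫⁻ t in Set.Ioi 0, f t := by
    have h := (Measure.measurePreserving_neg (volume : Measure ℝ)).setLIntegral_comp_preimage_emb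
      (MeasurableEquiv.neg ℝ).measurableEmbedding f (Set.Ioi 0)
    rw [← h]
    simp [hf]
  have hsplit : ∫⁻ t, f t = (∫⁻ t in Set.Ioi 0, f t) + ∫⁻ t in Set.Iio 0, f t := by
    rw [← lintegral_add_compl _ (measurableSet_Ioi (a := (0 : ℝ))), Set.compl_Ioi,
      setLIntegral_congr (Iio_ae_eq_Iic (a := (0 : ℝ)) (μ := volume))]
  rw [hsplit, hneg]
  exact ENNReal.add_ne_top.2 ⟨hpos, hpos⟩

/-- Reduces to a finite exponent: if g is bounded, g² ≤ ‖g‖_∞ g is integrable. -/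
theorem exists_lintegral_rpow_lt_top (hg0 : ∀ x, 0 ≤ g x) (hgi : Integrable g)
    (hp : ∃ p : ℝ≥0∞, 1 < p ∧ MemLp g p) :
    ∃ p : ℝ, 1 < p ∧ ∫⁻ x, ENNReal.ofReal (g x ^ p) < ∞ := by
  obtain ⟨p, hp1, hp⟩ := hp
  by_cases htop : p = ∞
  · subst htop
    refine ⟨2, by norm_num, ?_⟩
    have h := ae_le_lpNorm_exponent_top hp
    have hb := hgi.lintegral_lt_top
    refine lt_of_le_of_lt (lintegral_mono_ae (g := fun x => ENNReal.ofReal (lpNorm g ∞ volume) *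
      ENNReal.ofReal (g x)) ?_) ?_
    · filter_upwards [h] with x hx
      rw [← ENNReal.ofReal_mul ((norm_nonneg _).trans hx), Real.rpow_two, sq]
      rw [Real.norm_of_nonneg (hg0 x)] at hx
      exact ENNReal.ofReal_le_ofReal (mul_le_mul_of_nonneg_right hx (hg0 x))
    · rw [lintegral_const_mul' _ _ (by simp)]
      exact ENNReal.mul_lt_top (by simp) hb
  · refine ⟨p.toReal, ?_, ?_⟩
    · rw [← ENNReal.toReal_one]
      exact (ENNReal.toReal_lt_toReal (by simp) htop).2 hp1
    · have h := lintegral_rpow_enorm_lt_top_of_eLpNorm_lt_top (zero_lt_one.trans hp1).ne' htop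
        hp.eLpNorm_lt_top
      refine lt_of_le_of_lt (le_of_eq (lintegral_congr fun x => ?_)) h
      rw [Real.enorm_of_nonneg (hg0 x), ENNReal.ofReal_rpow_of_nonneg (hg0 x) (by simp)]

/-- The pointwise bound `mul_div_rpow_le` is integrated; q < 4/3 is exactly what makes 1 − 3q/2 >
−1, so the singular term is integrable at 0. -/
theorem lintegral_weight_ne_top (hg0 : ∀ x, 0 ≤ g x) (hg : Measurable g) (hgi : Integrable g)
    {p q : ℝ} (hp : ∫⁻ x, ENNReal.ofReal (g x ^ p) < ∞) (hq1 : 1 ≤ q) (hq2 : q < 4 / 3)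
    (hpq : 3 * q - 2 ≤ p) : ∫⁻ t, weight g q t ≠ ∞ := by
  have hle : ∀ᵐ t : ℝ, weight g q t ≤ ENNReal.ofReal (g t) + ENNReal.ofReal (g t ^ p) +
      ENNReal.ofReal ((Set.Iio 1).indicator (fun s => s ^ (1 - 3 * q / 2)) |t|) := by
    have h0 : ∀ᵐ t : ℝ, t ≠ 0 := by
      rw [ae_iff]
      simp
    filter_upwards [h0] with t ht
    have hs : 0 < |t| := abs_pos.2 ht
    rw [weight, ← ENNReal.ofReal_div_of_pos hs, ENNReal.ofReal_rpow_of_nonneg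
      (div_nonneg (hg0 t) hs.le) (by linarith), ← ENNReal.ofReal_mul hs.le,
      ← ENNReal.ofReal_add (hg0 t) (Real.rpow_nonneg (hg0 t) p), ← ENNReal.ofReal_add
        (add_nonneg (hg0 t) (Real.rpow_nonneg (hg0 t) p))
        (by
          simp only [Set.indicator]
          split_ifs
          · exact Real.rpow_nonneg hs.le _
          · exact le_rfl)]
    exact ENNReal.ofReal_le_ofReal (mul_div_rpow_le (hg0 t) hs hq1 hpq)
  refine ne_top_of_le_ne_top ?_ (lintegral_mono_ae hle)
  rw [lintegral_add_left (by fun_prop), lintegral_add_left (by fun_prop)]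
  exact ENNReal.add_ne_top.2 ⟨ENNReal.add_ne_top.2 ⟨hgi.lintegral_lt_top.ne, hp.ne⟩,
    lintegral_abs_rpow_ne_top (by linarith)⟩

/-- A product of `m` numbers is dominated by a sum of products of powers omitting one of them. -/
theorem prod_le_sum_mul_prod_weight {ι : Type*} [DecidableEq ι] (J : Finset ι) {m : ℕ} (hm : 2 ≤ m)
    (hJ : J.card = m) (t : ι → ℝ) (ht : ∀ j ∈ J, t j ≠ 0) :
    ∏ j ∈ J, ENNReal.ofReal (g (t j)) ≤
      ∑ i ∈ J, ENNReal.ofReal |t i| * ∏ j ∈ J.erase i, weight g (m / (m - 1)) (t j) := by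
  set a : ι → ℝ≥0∞ := fun j => ENNReal.ofReal (g (t j)) / ENNReal.ofReal |t j| with ha
  have hne : J.Nonempty := Finset.card_pos.1 (by omega)
  have hm1 : (0 : ℝ) < m - 1 := by
    have : (2 : ℝ) ≤ m := by exact_mod_cast hm
    linarith
  -- The omitted index minimizes a_j = g(t_j)/|t_j|. Then a_i^{m−1} ≤ R, the product of the other
  -- a_j, so a_i R ≤ R^{m/(m−1)}: this is the source of the exponent.
  obtain ⟨i, hi, hmin⟩ := J.exists_min_image a hne
  have hG : ∀ j ∈ J, ENNReal.ofReal (g (t j)) = ENNReal.ofReal |t j| * a j := fun j hj => by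
    rw [ha, ENNReal.mul_div_cancel (by simpa using ht j hj) (by simp)]
  set R := ∏ j ∈ J.erase i, a j with hR
  have h1 : a i ^ (m - 1) ≤ R := by
    rw [hR, ← hJ, ← Finset.card_erase_of_mem hi, ← Finset.prod_const]
    exact Finset.prod_le_prod' fun j hj => hmin j (Finset.mem_of_mem_erase hj)
  have h2 : a i ≤ R ^ (1 / ((m : ℝ) - 1)) := by
    rw [one_div, ENNReal.le_rpow_inv_iff hm1]
    refine le_trans (le_of_eq ?_) h1
    rw [← ENNReal.rpow_natCast]
    congr 1
    rw [Nat.cast_sub (by omega), Nat.cast_one]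
  have h3 : a i * R ≤ ∏ j ∈ J.erase i, a j ^ ((m : ℝ) / (m - 1)) := by
    rw [ENNReal.prod_rpow_of_nonneg (by positivity)]
    calc a i * R ≤ R ^ (1 / ((m : ℝ) - 1)) * R ^ (1 : ℝ) := by
          rw [ENNReal.rpow_one]
          gcongr
      _ = R ^ ((m : ℝ) / (m - 1)) := by
          rw [← ENNReal.rpow_add_of_nonneg _ _ (by positivity) zero_le_one]
          congr 1
          field_simp
          ring
  refine le_trans ?_ (Finset.single_le_sum
    (f := fun i => ENNReal.ofReal |t i| * ∏ j ∈ J.erase i, weight g (m / (m - 1)) (t j))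
    (fun _ _ => bot_le) hi)
  rw [Finset.prod_congr rfl hG, Finset.prod_mul_distrib, ← Finset.mul_prod_erase J a hi,
    ← Finset.mul_prod_erase J (fun j => ENNReal.ofReal |t j|) hi, mul_assoc]
  refine mul_le_mul_right ?_ _
  simp only [weight]
  rw [Finset.prod_mul_distrib]
  exact mul_le_mul_right h3 _

end Weight

/-! ### Uniform upper bound for integrals of block products -/

section UpperBound

variable {g : ℝ → ℝ}

theorem sliceConst_ne_zero (n : ℕ) : sliceConst n ≠ 0 := (unif_slice n).choose_spec.1

theorem sliceConst_ne_top (n : ℕ) : sliceConst n ≠ ∞ := (unif_slice n).choose_spec.2.1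

theorem measurable_coord {N : ℕ} : Measurable fun v : KacSphere N =>
    WithLp.ofLp (v : EuclideanSpace ℝ (Fin N)) :=
  (WithLp.measurable_ofLp 2 _).comp measurable_subtype_coe

theorem lintegral_unif_abs_mul (n : ℕ) (i : Fin (n + 1)) {Ψ : (Fin n → ℝ) → ℝ≥0∞}
    (hΨ : Measurable Ψ) :
    ∫⁻ v : KacSphere (n + 1), ENNReal.ofReal |(v : EuclideanSpace ℝ (Fin (n + 1))) i| *
      Ψ (i.removeNth (WithLp.ofLp (v : EuclideanSpace ℝ (Fin (n + 1))))) ∂(unif (n + 1)) =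
      2 * (sliceConst n * ∫⁻ y in {y | sqSum y < n + 1}, Ψ y) := by
  have hsl := (unif_slice n).choose_spec.2.2
  have e1 := hsl i _ (Or.inl rfl) Ψ hΨ
  have e2 := hsl i _ (Or.inr rfl) Ψ hΨ
  rw [two_mul]
  refine Eq.trans ?_ (congrArg₂ (· + ·) e1 e2)
  simp only
  rw [← lintegral_add_left]
  swap
  · exact ((Measurable.indicator (by fun_prop) measurableSet_Ioi).comp (by fun_prop)).mul
      (hΨ.comp ((measurable_removeNth i).comp measurable_coord))
  refine lintegral_congr fun v => ?_
  rw [← add_mul]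
  congr 1
  set t := (v : EuclideanSpace ℝ (Fin (n + 1))) i
  rcases lt_trichotomy t 0 with h | h | h
  · rw [Set.indicator_of_notMem (show t ∉ Set.Ioi 0 from h.le.not_gt),
      Set.indicator_of_mem (show t ∈ Set.Iio 0 from h), zero_add]
  · simp [h]
  · rw [Set.indicator_of_notMem (show t ∉ Set.Iio 0 from h.le.not_gt),
      Set.indicator_of_mem (show t ∈ Set.Ioi 0 from h), add_zero]

/-- Slicing along i only shows that v_j = 0 forces v_i = 0 almost surely. Doing this for every i
forces v = 0, which is not on the sphere. -/
theorem ae_coord_ne_zero {n : ℕ} (hn : 0 < n) (j : Fin (n + 1)) :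
    ∀ᵐ v : KacSphere (n + 1) ∂(unif (n + 1)), (v : EuclideanSpace ℝ (Fin (n + 1))) j ≠ 0 := by
  have key : ∀ i : Fin (n + 1), ∀ j' : Fin n, ∀ᵐ v : KacSphere (n + 1) ∂(unif (n + 1)),
      (v : EuclideanSpace ℝ (Fin (n + 1))) (i.succAbove j') = 0 →
        (v : EuclideanSpace ℝ (Fin (n + 1))) i = 0 := fun i j' => by
    have hm : MeasurableSet {y : Fin n → ℝ | y j' = 0} :=
      (measurable_pi_apply j') (measurableSet_singleton 0)
    have h0 : volume {y : Fin n → ℝ | y j' = 0} = 0 := Measure.pi_hyperplane _ j' 0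
    have h := lintegral_unif_abs_mul n i (measurable_one.indicator hm)
    have hz : ∫⁻ y in {y : Fin n → ℝ | sqSum y < n + 1}, {y | y j' = 0}.indicator (1 : (Fin n → ℝ) → ℝ≥0∞) y =
        0 := by
      refine le_antisymm ((setLIntegral_le_lintegral _ _).trans ?_) bot_le
      rw [lintegral_indicator_one hm, h0]
    rw [hz, mul_zero, mul_zero, lintegral_eq_zero_iff] at h
    swap
    · exact Measurable.mul (by fun_prop) ((measurable_one.indicator hm).comp
        ((measurable_removeNth i).comp measurable_coord))
    filter_upwards [h] with v hv hv0
    have hmem : i.removeNth (WithLp.ofLp (v : EuclideanSpace ℝ (Fin (n + 1)))) ∈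
        {y : Fin n → ℝ | y j' = 0} := hv0
    rw [Set.indicator_of_mem hmem] at hv
    simpa using hv
  filter_upwards [ae_all_iff.2 fun i => ae_all_iff.2 fun j' => key i j'] with v hv hj
  have hall : ∀ i, (v : EuclideanSpace ℝ (Fin (n + 1))) i = 0 := fun i => by
    by_cases hij : j = i
    · rw [← hij, hj]
    · obtain ⟨j', hj'⟩ := Fin.exists_succAbove_eq hij
      exact hv i j' (by rw [hj', hj])
  have hs := sqSum_coe v
  simp only [sqSum, hall] at hs
  have : (0 : ℝ) < ((n + 1 : ℕ) : ℝ) := by positivity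
  simp at hs
  linarith

/-- Removing the coordinate `v_i` from an integral over the sphere. -/
theorem lintegral_unif_abs_mul_prod_le {n : ℕ} (i : Fin (n + 1)) {f : Fin (n + 1) → ℝ → ℝ≥0∞}
    (hf : ∀ j, Measurable (f j)) (hfi : ∫⁻ t, f i t = 1) {W : (Fin (n + 1) → ℝ) → ℝ≥0∞}
    (hW : Measurable W) (hWi : ∀ x t, W (i.insertNth t (i.removeNth x)) = W x) :
    ∫⁻ v : KacSphere (n + 1), ENNReal.ofReal |(v : EuclideanSpace ℝ (Fin (n + 1))) i| *
      ((∏ j ∈ Finset.univ.erase i, f j ((v : EuclideanSpace ℝ (Fin (n + 1))) j)) *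
        W (WithLp.ofLp (v : EuclideanSpace ℝ (Fin (n + 1))))) ∂(unif (n + 1)) ≤
      2 * sliceConst n * ∫⁻ x : Fin (n + 1) → ℝ, (∏ j, f j (x j)) * W x := by
  have hins : Measurable fun y : Fin n → ℝ => (i.insertNth (0 : ℝ) y : Fin (n + 1) → ℝ) :=
    (MeasurableEquiv.piFinSuccAbove (fun _ => ℝ) i).symm.measurable.comp measurable_prodMk_left
  set Φ : (Fin n → ℝ) → ℝ≥0∞ := fun y => (∏ j, f (i.succAbove j) (y j)) * W (i.insertNth 0 y)
    with hΦ
  have hΦm : Measurable Φ := by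
    refine Measurable.mul ?_ (hW.comp hins)
    exact Finset.measurable_fun_prod _ fun j _ => (hf _).comp (measurable_pi_apply j)
  have hprod : ∀ x : Fin (n + 1) → ℝ, ∏ j ∈ Finset.univ.erase i, f j (x j) =
      ∏ j, f (i.succAbove j) (i.removeNth x j) := fun x => by
    change _ = ∏ j, f (i.succAbove j) (x (i.succAbove j))
    rw [← Finset.prod_image (s := Finset.univ) (g := i.succAbove) (f := fun j => f j (x j))
      (fun a _ b _ h => Fin.succAbove_right_injective h)]
    congr 1
    ext j
    simp
  calc _ = ∫⁻ v : KacSphere (n + 1), ENNReal.ofReal |(v : EuclideanSpace ℝ (Fin (n + 1))) i| *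
      Φ (i.removeNth (WithLp.ofLp (v : EuclideanSpace ℝ (Fin (n + 1))))) ∂(unif (n + 1)) := by
        refine lintegral_congr fun v => ?_
        rw [hprod]
        simp only [hΦ]
        rw [hWi]
    _ = 2 * (sliceConst n * ∫⁻ y in {y | sqSum y < n + 1}, Φ y) := lintegral_unif_abs_mul n i hΦm
    _ ≤ 2 * sliceConst n * ∫⁻ y, Φ y := by
        rw [mul_assoc]
        exact mul_le_mul_right (mul_le_mul_right (setLIntegral_le_lintegral _ _) _) _
    -- The removed coordinate is reinstated with the probability density f_i; neither Φ nor W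
    -- depends on it.
    _ = 2 * sliceConst n * ∫⁻ x : Fin (n + 1) → ℝ, (∏ j, f j (x j)) * W x := by
        congr 1
        have hm : Measurable fun x : Fin (n + 1) → ℝ => (∏ j, f j (x j)) * W x := by fun_prop
        rw [← ((volume_preserving_piFinSuccAbove (fun _ => ℝ) i).symm _).lintegral_comp hm,
          Measure.volume_eq_prod, lintegral_prod]
        swap
        · exact (hm.comp (MeasurableEquiv.measurable _)).aemeasurable
        have : ∀ (t : ℝ) (y : Fin n → ℝ),
            (∏ j, f j ((MeasurableEquiv.piFinSuccAbove (fun _ => ℝ) i).symm (t, y) j)) *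
              W ((MeasurableEquiv.piFinSuccAbove (fun _ => ℝ) i).symm (t, y)) =
            f i t * Φ y := fun t y => by
          have h1 : ((MeasurableEquiv.piFinSuccAbove (fun _ => ℝ) i).symm (t, y)) i = t :=
            Fin.insertNth_apply_same (α := fun _ => ℝ) i t y
          have h2 : i.removeNth ((MeasurableEquiv.piFinSuccAbove (fun _ => ℝ) i).symm (t, y)) = y :=
            Fin.removeNth_insertNth (α := fun _ => ℝ) i t y
          rw [← Finset.mul_prod_erase _ _ (Finset.mem_univ i), hprod, h1, h2, ← hWi _ 0, h2,
            mul_assoc]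
        simp_rw [this, lintegral_const_mul _ hΦm]
        rw [lintegral_mul_const _ (hf i), hfi, one_mul]

/-- The m coordinates outside the blocks pay for the slicing through `prod_le_sum_mul_prod_weight`;
the rest is then an integral over independent coordinates, in which each block contributes ∫ F
dν^{⊗k} = 1. Hence K does not depend on k, M, n or F. -/
theorem exists_lintegral_tensorDensity_mul_le (hg : Measurable g) (hg0 : ∀ x, 0 ≤ g x)
    (h1 : ∫ x, g x = 1) (hp : ∃ p : ℝ≥0∞, 1 < p ∧ MemLp g p) :
    ∃ m : ℕ, ∃ K : ℝ≥0∞, K ≠ ∞ ∧ ∀ (k M n : ℕ) (F : (Fin k → ℝ) → ℝ≥0∞), Measurable F →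
      ∫⁻ y, F y ∂(Measure.pi fun _ => densityMeasure g) = 1 → m ≤ n + 1 →
      ∀ e : Fin M × Fin k → Fin (n + 1), Function.Injective e → (∀ p, m ≤ (e p).val) →
      ∫⁻ v : KacSphere (n + 1), tensorDensity g (n + 1) v *
        ∏ l, F (fun i => (v : EuclideanSpace ℝ (Fin (n + 1))) (e (l, i))) ∂(unif (n + 1)) ≤
        sliceConst n * K := by
  have hprob := isProbabilityMeasure_densityMeasure hg0 h1
  have hgi : Integrable g := by
    by_contra h
    rw [integral_undef h] at h1
    exact zero_ne_one h1
  have hG1 : ∫⁻ t, ENNReal.ofReal (g t) = 1 := by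
    rw [← ofReal_integral_eq_lintegral_ofReal hgi (Eventually.of_forall hg0), h1, ENNReal.ofReal_one]
  obtain ⟨p, hp1, hp⟩ := exists_lintegral_rpow_lt_top hg0 hgi hp
  -- With q = 1 + 1/(m − 1), the ceiling gives 3q − 2 ≤ p and the summand 5 gives q ≤ 5/4 < 4/3.
  set m := ⌈3 / (p - 1)⌉₊ + 5 with hm
  set q : ℝ := m / (m - 1) with hq
  have hm5 : (4 : ℝ) + ⌈3 / (p - 1)⌉₊ = m - 1 := by
    rw [hm]
    push_cast
    ring
  have hmc : 3 / (p - 1) ≤ m - 1 := by linarith [Nat.le_ceil (3 / (p - 1))]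
  have hm0 : (4 : ℝ) ≤ m - 1 := by
    have : (0 : ℝ) ≤ ⌈3 / (p - 1)⌉₊ := Nat.cast_nonneg _
    linarith
  have hq' : q = 1 + 1 / ((m : ℝ) - 1) := by
    rw [hq]
    have : (m : ℝ) - 1 ≠ 0 := by linarith
    field_simp
    ring
  have hb : ∫⁻ t, weight g q t ≠ ∞ := by
    refine lintegral_weight_ne_top hg0 hg hgi hp ?_ ?_ ?_
    · rw [hq']
      have : 0 ≤ 1 / ((m : ℝ) - 1) := by positivity
      linarith
    · rw [hq']
      have : 1 / ((m : ℝ) - 1) ≤ 1 / 4 := one_div_le_one_div_of_le (by norm_num) hm0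
      linarith
    · rw [hq']
      have : 3 / ((m : ℝ) - 1) ≤ p - 1 := by
        rw [div_le_iff₀ (by linarith)] at hmc ⊢
        linarith
      have e : 3 * (1 / ((m : ℝ) - 1)) = 3 / (m - 1) := by ring
      linarith
  have hwm := measurable_weight hg q
  -- Adding g to the weight guarantees I ≥ 1, so normalization by I is legitimate and powers of I
  -- increase.
  set I := ∫⁻ t, (weight g q t + ENNReal.ofReal (g t)) with hI
  have hIsum : I = (∫⁻ t, weight g q t) + 1 := by rw [hI, lintegral_add_left hwm, hG1]
  have hI1 : 1 ≤ I := by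
    rw [hIsum]
    exact le_add_self
  have hIt : I ≠ ∞ := by
    rw [hIsum]
    exact ENNReal.add_ne_top.2 ⟨hb, ENNReal.one_ne_top⟩
  have hI0 : I ≠ 0 := (zero_lt_one.trans_le hI1).ne'
  refine ⟨m, m * (2 * I ^ m), by finiteness, fun k M n F hF hF1 hmn e he hem => ?_⟩
  set W : (Fin (n + 1) → ℝ) → ℝ≥0∞ := fun x => ∏ l, F (fun i => x (e (l, i))) with hW
  have hWm : Measurable W := Finset.measurable_fun_prod _ fun l _ => hF.comp (by fun_prop)
  set J : Finset (Fin (n + 1)) := Finset.univ.filter fun j => j.val < m with hJ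
  have hJc : J.card = m := by
    rw [hJ, Fin.card_filter_val_lt]
    exact min_eq_right hmn
  -- a normalized density for each coordinate when `i` is removed
  set D : ℝ → ℝ≥0∞ := fun t => I⁻¹ * (weight g q t + ENNReal.ofReal (g t)) with hD
  have hDm : Measurable D := by fun_prop
  have hD1 : ∫⁻ t, D t = 1 := by
    rw [hD, lintegral_const_mul' _ _ (by simp [hI0]), ← hI, ENNReal.inv_mul_cancel hI0 hIt]
  have hwD : ∀ t, weight g q t ≤ I * D t := fun t => by
    simp only [hD]
    rw [← mul_assoc, ENNReal.mul_inv_cancel hI0 hIt, one_mul]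
    exact le_self_add
  set f : Fin (n + 1) → ℝ → ℝ≥0∞ := fun j => if j ∈ J then D else fun t => ENNReal.ofReal (g t)
    with hf
  have hfm : ∀ j, Measurable (f j) := fun j => by
    simp only [hf]
    split_ifs
    · exact hDm
    · fun_prop
  have hf1 : ∀ j, ∫⁻ t, f j t = 1 := fun j => by
    simp only [hf]
    split_ifs
    · exact hD1
    · exact hG1
  have hfprob : ∀ j, IsProbabilityMeasure ((volume : Measure ℝ).withDensity (f j)) := fun j =>
    ⟨by rw [withDensity_apply _ MeasurableSet.univ, setLIntegral_univ, hf1]⟩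
  have hterm : ∀ i ∈ J, ∫⁻ v : KacSphere (n + 1),
      ENNReal.ofReal |(v : EuclideanSpace ℝ (Fin (n + 1))) i| *
      ((∏ j ∈ Finset.univ.erase i, f j ((v : EuclideanSpace ℝ (Fin (n + 1))) j)) *
        W (WithLp.ofLp (v : EuclideanSpace ℝ (Fin (n + 1))))) ∂(unif (n + 1)) ≤
      2 * sliceConst n := fun i hi => by
    refine (lintegral_unif_abs_mul_prod_le i hfm (hf1 i) hWm fun x t => ?_).trans ?_
    · simp only [hW]
      refine Finset.prod_congr rfl fun l _ => ?_
      congr 1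
      ext i'
      have hne : e (l, i') ≠ i := fun h => by
        have h2 := hem (l, i')
        rw [h] at h2
        rw [hJ, Finset.mem_filter] at hi
        omega
      obtain ⟨z, hz⟩ := Fin.exists_succAbove_eq hne
      rw [← hz, Fin.insertNth_apply_succAbove]
      rfl
    · have hpi : ∫⁻ x : Fin (n + 1) → ℝ, (∏ j, f j (x j)) * W x =
          ∫⁻ x, W x ∂(Measure.pi fun j => (volume : Measure ℝ).withDensity (f j)) := by
        rw [pi_withDensity hfm, lintegral_withDensity_eq_lintegral_mul _ (by fun_prop) hWm]
        rfl
      rw [hpi, lintegral_prod_blocks _ (densityMeasure g) he (fun p => ?_) hF, hF1, one_pow,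
        mul_one]
      have : e p ∉ J := fun h => by
        have h2 := hem p
        rw [hJ, Finset.mem_filter] at h
        omega
      simp only [hf, if_neg this]
      rfl
  have hpoint : ∀ᵐ v : KacSphere (n + 1) ∂(unif (n + 1)), tensorDensity g (n + 1) v *
      W (WithLp.ofLp (v : EuclideanSpace ℝ (Fin (n + 1)))) ≤ ∑ i ∈ J, I ^ m *
      (ENNReal.ofReal |(v : EuclideanSpace ℝ (Fin (n + 1))) i| *
      ((∏ j ∈ Finset.univ.erase i, f j ((v : EuclideanSpace ℝ (Fin (n + 1))) j)) *
        W (WithLp.ofLp (v : EuclideanSpace ℝ (Fin (n + 1)))))) := by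
    filter_upwards [ae_all_iff.2 fun j => ae_coord_ne_zero (show 0 < n by omega) j] with v hv
    set x := WithLp.ofLp (v : EuclideanSpace ℝ (Fin (n + 1)))
    have hsplit : tensorDensity g (n + 1) v =
        (∏ j ∈ J, ENNReal.ofReal (g (x j))) * ∏ j ∈ Jᶜ, ENNReal.ofReal (g (x j)) :=
      (Finset.prod_mul_prod_compl J _).symm
    have hd := prod_le_sum_mul_prod_weight (g := g) J (by omega) hJc x fun j _ => hv j
    rw [hsplit]
    refine (mul_le_mul_left (mul_le_mul_left hd _) _).trans ?_
    rw [Finset.sum_mul, Finset.sum_mul]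
    refine Finset.sum_le_sum fun i hi => ?_
    have hw : ∏ j ∈ J.erase i, weight g q (x j) ≤ I ^ m * ∏ j ∈ J.erase i, f j (x j) := by
      calc ∏ j ∈ J.erase i, weight g q (x j) ≤ ∏ j ∈ J.erase i, I * f j (x j) := by
            refine Finset.prod_le_prod' fun j hj => ?_
            simp only [hf, if_pos (Finset.mem_of_mem_erase hj)]
            exact hwD _
        _ = I ^ (m - 1) * ∏ j ∈ J.erase i, f j (x j) := by
            rw [Finset.prod_mul_distrib, Finset.prod_const, Finset.card_erase_of_mem hi, hJc]
        _ ≤ _ := mul_le_mul_left (pow_le_pow_right₀ hI1 (Nat.sub_le _ _)) _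
    have hcompl : ∏ j ∈ Jᶜ, ENNReal.ofReal (g (x j)) = ∏ j ∈ Jᶜ, f j (x j) :=
      Finset.prod_congr rfl fun j hj => by
        simp only [hf, if_neg (Finset.mem_compl.1 hj)]
    have herase : ∏ j ∈ Finset.univ.erase i, f j (x j) =
        (∏ j ∈ J.erase i, f j (x j)) * ∏ j ∈ Jᶜ, f j (x j) := by
      rw [← Finset.prod_union]
      · congr 1
        ext j
        simp only [Finset.mem_erase, Finset.mem_univ, and_true, Finset.mem_union,
          Finset.mem_compl]
        by_cases hj : j ∈ J
        · simp [hj]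
        · have : j ≠ i := fun h => hj (h ▸ hi)
          simp [hj, this]
      · exact Finset.disjoint_left.2 fun j hj hj' =>
          Finset.mem_compl.1 hj' (Finset.mem_of_mem_erase hj)
    rw [hcompl, herase]
    calc _ ≤ ENNReal.ofReal |x i| * (I ^ m * ∏ j ∈ J.erase i, f j (x j)) *
          (∏ j ∈ Jᶜ, f j (x j)) * W x := by gcongr
      _ = _ := by ring
  refine (lintegral_mono_ae hpoint).trans ?_
  have hmeas : ∀ i, Measurable fun v : KacSphere (n + 1) =>
      (ENNReal.ofReal |(v : EuclideanSpace ℝ (Fin (n + 1))) i| *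
      ((∏ j ∈ Finset.univ.erase i, f j ((v : EuclideanSpace ℝ (Fin (n + 1))) j)) *
        W (WithLp.ofLp (v : EuclideanSpace ℝ (Fin (n + 1)))))) := fun i => by
    refine Measurable.mul (by fun_prop) (Measurable.mul ?_ (hWm.comp measurable_coord))
    exact Finset.measurable_fun_prod _ fun j _ => (hfm j).comp (by fun_prop)
  rw [lintegral_finsetSum _ fun i _ => (hmeas i).const_mul _]
  calc _ ≤ ∑ i ∈ J, I ^ m * (2 * sliceConst n) := by
        refine Finset.sum_le_sum fun i hi => ?_
        rw [lintegral_const_mul _ (hmeas i)]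
        gcongr
        exact hterm i hi
    _ = sliceConst n * (m * (2 * I ^ m)) := by
        rw [Finset.sum_const, hJc, nsmul_eq_mul]
        ring

end UpperBound

/-! ### From the finite-N entropy bound to the liminf inequality -/

section EntropyPerParticle

variable {g : ℝ → ℝ}

theorem exists_perm_comp_eq {k N : ℕ} {a b : Fin k → Fin N} (ha : Function.Injective a)
    (hb : Function.Injective b) : ∃ τ : Equiv.Perm (Fin N), ∀ i, τ (a i) = b i := by
  classical
  refine ⟨((Equiv.ofInjective a ha).symm.trans (Equiv.ofInjective b hb)).extendSubtype,
    fun i => ?_⟩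
  rw [Equiv.extendSubtype_apply_of_mem _ _ (Set.mem_range_self i)]
  simp

theorem measurable_permute {N : ℕ} (τ : Equiv.Perm (Fin N)) : Measurable (permute τ) :=
  Measurable.subtype_mk ((WithLp.measurable_toLp 2 _).comp
    (measurable_pi_lambda _ fun i => (measurable_pi_apply (τ i)).comp measurable_coord))

/-- Any k distinct coordinates can be moved to the first k by a permutation, under which m is
invariant. -/
theorem integral_comp_coords_eq_marginal {k N : ℕ} {m : ProbabilityMeasure (KacSphere N)}
    (hm : IsSymmetric m) {b : Fin k → Fin N} (hb : Function.Injective b) (ψ : (Fin k → ℝ) → ℝ)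
    (hψ : Measurable ψ) :
    ∫ v : KacSphere N, ψ (fun i => (v : EuclideanSpace ℝ (Fin N)) (b i)) ∂(m : Measure (KacSphere N)) =
      ∫ y, ψ y ∂(marginal k m : Measure (Fin k → ℝ)) := by
  have hk : k ≤ N := by simpa using Fintype.card_le_of_injective b hb
  obtain ⟨τ, hτ⟩ := exists_perm_comp_eq (Fin.castLE_injective hk) hb
  have hmeas : Measurable fun v : KacSphere N => ψ (firstCoords k N v) :=
    hψ.comp (measurable_firstCoords k N)
  have e1 : ∫ y, ψ y ∂(marginal k m : Measure (Fin k → ℝ)) =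
      ∫ v, ψ (firstCoords k N v) ∂(m : Measure (KacSphere N)) := by
    rw [marginal, ProbabilityMeasure.toMeasure_map,
      integral_map (measurable_firstCoords k N).aemeasurable hψ.aestronglyMeasurable]
  rw [e1]
  conv_rhs => rw [← hm τ]
  rw [integral_map (measurable_permute τ).aemeasurable hmeas.aestronglyMeasurable]
  refine integral_congr_ae (Eventually.of_forall fun v => ?_)
  simp only
  congr 1
  ext i
  have hi : (i : ℕ) < N := i.2.trans_le hk
  simp only [firstCoords, hi, dif_pos]
  rw [← hτ i]
  rfl

theorem measurable_tensorDensity (hg : Measurable g) (N : ℕ) : Measurable (tensorDensity g N) := by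
  unfold tensorDensity
  exact Finset.measurable_fun_prod _ fun j _ => by fun_prop

theorem isProbabilityMeasure_condTensor {N : ℕ} (h0 : Z g N ≠ 0) (ht : Z g N ≠ ∞) :
    IsProbabilityMeasure (condTensor g N) := by
  refine ⟨?_⟩
  rw [condTensor, Measure.smul_apply, withDensity_apply _ MeasurableSet.univ, setLIntegral_univ,
    smul_eq_mul, ← Z, ENNReal.inv_mul_cancel h0 ht]

theorem lintegral_condTensor (hg : Measurable g) (N : ℕ) {F : KacSphere N → ℝ≥0∞}
    (hF : Measurable F) :
    ∫⁻ v, F v ∂(condTensor g N) = (Z g N)⁻¹ * ∫⁻ v, tensorDensity g N v * F v ∂(unif N) := by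
  rw [condTensor, lintegral_smul_measure,
    lintegral_withDensity_eq_lintegral_mul _ (measurable_tensorDensity hg N) hF]
  rfl

/-- Finite-`n` entropy bound: blocks of `k` coordinates tested against a normalized `ψ`. -/
theorem eventually_le_klDiv (hg : Measurable g) (hg0 : ∀ x, 0 ≤ g x)
    (h1 : ∫ x, g x = 1) (h2 : ∫ x, g x * x ^ 2 = 1) (h4 : Integrable fun x => g x * x ^ 4)
    (hp : ∃ p : ℝ≥0∞, 1 < p ∧ MemLp g p) :
    ∃ m₀ : ℕ, ∃ B : ℝ, ∀ ε : ℝ, 0 < ε → ∀ᶠ N : ℕ in atTop, (0 < Z g N ∧ Z g N < ∞) ∧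
      ∀ m : ProbabilityMeasure (KacSphere N), IsSymmetric m → ∀ (k : ℕ) (ψ : (Fin k → ℝ) → ℝ)
        (C : ℝ), Measurable ψ → (∀ y, |ψ y| ≤ C) →
        ∫⁻ y, ENNReal.ofReal (Real.exp (ψ y)) ∂(Measure.pi fun _ => densityMeasure g) = 1 →
        ENNReal.ofReal (((N - m₀) / k : ℕ) * ∫ y, ψ y ∂(marginal k m : Measure (Fin k → ℝ)) -
          (B + ε * N)) ≤ klDiv (m : Measure (KacSphere N)) (condTensor g N) := by
  obtain ⟨m₀, K, hK, hup⟩ := exists_lintegral_tensorDensity_mul_le hg hg0 h1 hp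
  -- Replacing K by max(K, 1) makes its logarithm meaningful even if K = 0.
  set K' := max K 1 with hK'
  have hK't : K' ≠ ∞ := by simp [hK', hK]
  have hK'1 : 1 ≤ K'.toReal := by
    rw [← ENNReal.toReal_one]
    exact ENNReal.toReal_mono hK't (le_max_right _ _)
  refine ⟨m₀, Real.log K'.toReal, fun ε hε => ?_⟩
  have hlow := (tendsto_sub_atTop_nat 1).eventually
    (eventually_sliceConst_mul_exp_le_Z hg hg0 h1 h2 h4 hε)
  filter_upwards [hlow, eventually_ge_atTop (m₀ + 1)] with N hN hNm
  obtain ⟨n, rfl⟩ : ∃ n, N = n + 1 := ⟨N - 1, by omega⟩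
  rw [Nat.add_sub_cancel] at hN
  have hc0 := sliceConst_ne_zero n
  have hct := sliceConst_ne_top n
  have hprob := isProbabilityMeasure_densityMeasure hg0 h1
  have hexp0 : ENNReal.ofReal (Real.exp (-(ε * n))) ≠ 0 := by simp [Real.exp_pos]
  have hZ0 : Z g (n + 1) ≠ 0 :=
    ((ENNReal.mul_pos hc0 hexp0).trans_le hN).ne'
  have hZt : Z g (n + 1) ≠ ∞ := by
    -- With no blocks at all the upper bound is one for Z itself.
    have h := hup 0 0 n (fun _ => 1) measurable_const (by simp) (by omega)
      (fun p => p.1.elim0) (fun p => p.1.elim0) (fun p => p.1.elim0)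
    simp only [Finset.univ_eq_empty, Finset.prod_empty, mul_one] at h
    exact ne_top_of_le_ne_top (ENNReal.mul_ne_top hct hK) h
  have hcond := isProbabilityMeasure_condTensor hZ0 hZt
  refine ⟨⟨pos_iff_ne_zero.2 hZ0, lt_top_iff_ne_top.2 hZt⟩, fun m hm k ψ C hψ hC hψ1 => ?_⟩
  set M := (n + 1 - m₀) / k with hM
  have hMk : m₀ + M * k ≤ n + 1 := by
    have : M * k ≤ n + 1 - m₀ := Nat.div_mul_le_self (n + 1 - m₀) k
    omega
  -- The blocks are consecutive and start after the m₀ reserved coordinates; fewer than k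
  -- coordinates may be left over when k > 0.
  set e : Fin M × Fin k → Fin (n + 1) := fun p =>
    ⟨m₀ + (finProdFinEquiv p).val, by have := (finProdFinEquiv p).2; omega⟩ with he
  have heinj : Function.Injective e := fun p p' h => by
    simp only [he, Fin.mk.injEq, add_right_inj] at h
    exact finProdFinEquiv.injective (Fin.ext h)
  set Φ : KacSphere (n + 1) → ℝ := fun v =>
    ∑ l, ψ (fun i => (v : EuclideanSpace ℝ (Fin (n + 1))) (e (l, i))) with hΦ
  have hblock : ∀ l, Measurable fun v : KacSphere (n + 1) =>
      ψ (fun i => (v : EuclideanSpace ℝ (Fin (n + 1))) (e (l, i))) := fun l =>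
    hψ.comp (measurable_pi_lambda _ fun i => (measurable_pi_apply _).comp measurable_coord)
  have hΦm : Measurable Φ := Finset.measurable_fun_sum _ fun l _ => hblock l
  have hΦC : ∀ v, |Φ v| ≤ M * C := fun v => by
    refine (Finset.abs_sum_le_sum_abs _ _).trans ((Finset.sum_le_sum fun l _ => hC _).trans ?_)
    simp
  have hdv := ofReal_sub_log_le_klDiv (m : Measure (KacSphere (n + 1))) (condTensor g (n + 1))
    hΦm hΦC
  have hint : ∫ v, Φ v ∂(m : Measure (KacSphere (n + 1))) =
      M * ∫ y, ψ y ∂(marginal k m : Measure (Fin k → ℝ)) := by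
    simp only [hΦ]
    rw [integral_finsetSum _ fun l _ => integrable_of_bounded (hblock l) fun v => hC _]
    rw [Finset.sum_congr rfl fun l _ => integral_comp_coords_eq_marginal hm
      (b := fun i => e (l, i)) (fun i i' h => (Prod.mk.inj (heinj h)).2) ψ hψ]
    simp
  -- The unknown slicing constant cancels between the upper bound for the numerator and the lower
  -- bound for Z.
  have hexpint : ∫ v, Real.exp (Φ v) ∂(condTensor g (n + 1)) ≤ K'.toReal * Real.exp (ε * n) := by
    rw [integral_eq_lintegral_of_nonneg_ae (Eventually.of_forall fun v => (Real.exp_pos _).le)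
      (Real.measurable_exp.comp hΦm).aestronglyMeasurable]
    refine ENNReal.toReal_le_of_le_ofReal (by positivity) ?_
    rw [lintegral_condTensor hg _ (by fun_prop), ENNReal.ofReal_mul (by positivity),
      ENNReal.ofReal_toReal hK't]
    have hF := hup k M n (fun y => ENNReal.ofReal (Real.exp (ψ y))) (by fun_prop) hψ1 (by omega) e
      heinj fun p => Nat.le_add_right _ _
    have hexpΦ : ∀ v : KacSphere (n + 1), ENNReal.ofReal (Real.exp (Φ v)) = ∏ l,
        ENNReal.ofReal (Real.exp (ψ (fun i => (v : EuclideanSpace ℝ (Fin (n + 1))) (e (l, i))))) :=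
      fun v => by
        rw [← ENNReal.ofReal_prod_of_nonneg fun _ _ => (Real.exp_pos _).le, ← Real.exp_sum]
    simp_rw [hexpΦ]
    refine (mul_le_mul_right hF _).trans ?_
    rw [← ENNReal.div_eq_inv_mul]
    refine ENNReal.div_le_of_le_mul ?_
    calc sliceConst n * K ≤ sliceConst n * K' := by
          gcongr
          exact le_max_left _ _
      _ = K' * ENNReal.ofReal (Real.exp (ε * n)) *
          (sliceConst n * ENNReal.ofReal (Real.exp (-(ε * n)))) := by
          have : ENNReal.ofReal (Real.exp (ε * n)) * ENNReal.ofReal (Real.exp (-(ε * n))) = 1 := by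
            rw [← ENNReal.ofReal_mul (Real.exp_pos _).le, ← Real.exp_add]
            simp
          calc sliceConst n * K' = sliceConst n * K' * (ENNReal.ofReal (Real.exp (ε * n)) *
                ENNReal.ofReal (Real.exp (-(ε * n)))) := by rw [this, mul_one]
            _ = _ := by ring
      _ ≤ _ := by gcongr
  refine le_trans (ENNReal.ofReal_le_ofReal ?_) hdv
  rw [hint]
  have hlog : Real.log (∫ v, Real.exp (Φ v) ∂(condTensor g (n + 1))) ≤
      Real.log K'.toReal + ε * n := by
    have h := Real.log_le_log (integral_exp_pos (integrable_exp_of_bounded hΦm hΦC)) hexpint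
    rwa [Real.log_mul (by positivity) (Real.exp_pos _).ne', Real.log_exp] at h
  push_cast
  linarith

theorem tendsto_div_div (m₀ : ℕ) {k : ℕ} (hk : 0 < k) :
    Tendsto (fun N : ℕ => (((N - m₀) / k : ℕ) : ℝ) / N) atTop (𝓝 (1 / k)) := by
  have hk' : (0 : ℝ) < k := by exact_mod_cast hk
  have hlow : Tendsto (fun N : ℕ => 1 / (k : ℝ) - (m₀ / k + 1) / N) atTop (𝓝 (1 / k)) := by
    simpa using (tendsto_const_div_atTop_nhds_zero_nat ((m₀ : ℝ) / k + 1)).const_sub (1 / (k : ℝ))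
  refine tendsto_of_tendsto_of_tendsto_of_le_of_le' hlow tendsto_const_nhds ?_ ?_
  · filter_upwards [eventually_gt_atTop m₀] with N hN
    have hN0 : (0 : ℝ) < N := by exact_mod_cast (by omega : 0 < N)
    have h := Nat.lt_div_mul_add (a := N - m₀) hk
    have h' : (N : ℝ) < ((N - m₀) / k : ℕ) * k + k + m₀ := by
      exact_mod_cast (by omega : N < (N - m₀) / k * k + k + m₀)
    rw [div_sub_div _ _ hk'.ne' hN0.ne', div_le_div_iff₀ (by positivity) hN0]
    have e : (1 * (N : ℝ) - k * (m₀ / k + 1)) = N - m₀ - k := by field_simp; ring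
    rw [e]
    nlinarith
  · filter_upwards [eventually_gt_atTop m₀] with N hN
    have hN0 : (0 : ℝ) < N := by exact_mod_cast (by omega : 0 < N)
    have h := Nat.div_mul_le_self (N - m₀) k
    have h' : (((N - m₀) / k : ℕ) : ℝ) * k ≤ N := by
      exact_mod_cast (by omega : (N - m₀) / k * k ≤ N)
    rw [div_le_div_iff₀ hN0 hk']
    linarith

/-- Subtracting log ∫ e^φ dν^{⊗k} from φ normalizes it for the finite-N bound. The constant B
disappears after division by N, and ε is sent to 0 last. -/
theorem ofReal_div_le_liminf_klDiv (hg : Measurable g) (hg0 : ∀ x, 0 ≤ g x)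
    (h1 : ∫ x, g x = 1) (h2 : ∫ x, g x * x ^ 2 = 1) (h4 : Integrable fun x => g x * x ^ 4)
    (hp : ∃ p : ℝ≥0∞, 1 < p ∧ MemLp g p) {m : ∀ N : ℕ, ProbabilityMeasure (KacSphere N)}
    (hm : ∀ N, 0 < N → IsSymmetric (m N)) {k : ℕ} (hk : 0 < k)
    {μk : ProbabilityMeasure (Fin k → ℝ)} (hlim : Tendsto (fun N => marginal k (m N)) atTop (𝓝 μk))
    (φ : BoundedContinuousFunction (Fin k → ℝ) ℝ) :
    ENNReal.ofReal ((∫ y, φ y ∂(μk : Measure (Fin k → ℝ)) -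
      Real.log (∫ y, Real.exp (φ y) ∂(Measure.pi fun _ : Fin k => densityMeasure g))) / k) ≤
      liminf (fun N : ℕ => klDiv (m N : Measure (KacSphere N)) (condTensor g N) / N) atTop := by
  obtain ⟨m₀, B, hB⟩ := eventually_le_klDiv hg hg0 h1 h2 h4 hp
  have hprob := isProbabilityMeasure_densityMeasure hg0 h1
  have hφm : Measurable φ := φ.continuous.measurable
  have hφi : Integrable (fun y => Real.exp (φ y)) (Measure.pi fun _ : Fin k => densityMeasure g) :=
    integrable_exp_of_bounded hφm fun y => φ.norm_coe_le_norm y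
  have hI := integral_exp_pos hφi
  set I := ∫ y, Real.exp (φ y) ∂(Measure.pi fun _ : Fin k => densityMeasure g) with hIdef
  have hψ1 : ∫⁻ y, ENNReal.ofReal (Real.exp (φ y - Real.log I))
      ∂(Measure.pi fun _ : Fin k => densityMeasure g) = 1 := by
    simp_rw [Real.exp_sub, Real.exp_log hI]
    rw [← ofReal_integral_eq_lintegral_ofReal (hφi.div_const I)
      (Eventually.of_forall fun y => by positivity), integral_div, ← hIdef, div_self hI.ne',
      ENNReal.ofReal_one]
  have hint : ∀ ρ : ProbabilityMeasure (Fin k → ℝ), ∫ y, (φ y - Real.log I) ∂(ρ : Measure (Fin k → ℝ)) =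
      ∫ y, φ y ∂(ρ : Measure (Fin k → ℝ)) - Real.log I := fun ρ => by
    rw [integral_sub (φ.integrable _) (integrable_const _)]
    simp
  set A := ∫ y, φ y ∂(μk : Measure (Fin k → ℝ)) - Real.log I with hA
  have hAlim : Tendsto (fun N => ∫ y, (φ y - Real.log I) ∂(marginal k (m N) : Measure (Fin k → ℝ)))
      atTop (𝓝 A) := by
    simp_rw [hint]
    exact (ProbabilityMeasure.tendsto_iff_forall_integral_tendsto.1 hlim φ).sub_const _
  have hmain : ∀ ε : ℝ, 0 < ε → ENNReal.ofReal (A / k - ε) ≤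
      liminf (fun N : ℕ => klDiv (m N : Measure (KacSphere N)) (condTensor g N) / N) atTop := by
    intro ε hε
    have hb : Tendsto (fun N : ℕ => ENNReal.ofReal ((((N - m₀) / k : ℕ) : ℝ) / N *
        ∫ y, (φ y - Real.log I) ∂(marginal k (m N) : Measure (Fin k → ℝ)) - (B / N + ε))) atTop
        (𝓝 (ENNReal.ofReal (A / k - ε))) := by
      refine (ENNReal.continuous_ofReal.tendsto _).comp ?_
      have := ((tendsto_div_div m₀ hk).mul hAlim).sub
        ((tendsto_const_div_atTop_nhds_zero_nat B).add_const ε)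
      rw [one_div_mul_eq_div, zero_add] at this
      exact this
    rw [← hb.liminf_eq]
    refine liminf_le_liminf ?_
    filter_upwards [hB ε hε, eventually_gt_atTop 0] with N hN hN0
    have hN0' : (0 : ℝ) < N := by exact_mod_cast hN0
    have h := hN.2 (m N) (hm N hN0) k (fun y => φ y - Real.log I) (‖φ‖ + |Real.log I|) (by fun_prop)
      (fun y => (abs_sub _ _).trans (add_le_add_left (φ.norm_coe_le_norm y) _)) hψ1
    rw [ENNReal.le_div_iff_mul_le (Or.inl (by exact_mod_cast hN0.ne')) (Or.inl (by simp))]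
    refine le_trans (le_of_eq ?_) h
    rw [← ENNReal.ofReal_natCast, ← ENNReal.ofReal_mul' hN0'.le]
    congr 1
    field_simp
  have hcont : Tendsto (fun ε : ℝ => ENNReal.ofReal (A / k - ε)) (𝓝[>] 0)
      (𝓝 (ENNReal.ofReal (A / k))) := by
    have : Tendsto (fun ε : ℝ => ENNReal.ofReal (A / k - ε)) (𝓝 0)
        (𝓝 (ENNReal.ofReal (A / k - 0))) := 
      (ENNReal.continuous_ofReal.comp (by fun_prop)).tendsto 0
    rw [sub_zero] at this
    exact this.mono_left nhdsWithin_le_nhds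
  exact le_of_tendsto hcont (by filter_upwards [self_mem_nhdsWithin] with ε hε using hmain ε hε)

/-- Asymptotic lower bound for the entropy of a `k`-particle limit. -/
theorem klDiv_div_le_liminf (hg : Measurable g) (hg0 : ∀ x, 0 ≤ g x)
    (h1 : ∫ x, g x = 1) (h2 : ∫ x, g x * x ^ 2 = 1) (h4 : Integrable fun x => g x * x ^ 4)
    (hp : ∃ p : ℝ≥0∞, 1 < p ∧ MemLp g p) {m : ∀ N : ℕ, ProbabilityMeasure (KacSphere N)}
    (hm : ∀ N, 0 < N → IsSymmetric (m N)) {k : ℕ} (hk : 0 < k)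
    {μk : ProbabilityMeasure (Fin k → ℝ)}
    (hlim : Tendsto (fun N => marginal k (m N)) atTop (𝓝 μk)) :
    klDiv (μk : Measure (Fin k → ℝ)) (Measure.pi fun _ : Fin k => densityMeasure g) / k ≤
      liminf (fun N : ℕ => klDiv (m N : Measure (KacSphere N)) (condTensor g N) / N) atTop := by
  have hprob := isProbabilityMeasure_densityMeasure hg0 h1
  have key := ofReal_div_le_liminf_klDiv hg hg0 h1 h2 h4 hp hm hk hlim
  set L := liminf (fun N : ℕ => klDiv (m N : Measure (KacSphere N)) (condTensor g N) / N) atTop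
  by_cases hL : L = ∞
  · rw [hL]
    exact le_top
  have hk' : (0 : ℝ) < k := by exact_mod_cast hk
  have h := klDiv_le_of_forall_boundedContinuous (μk : Measure (Fin k → ℝ))
    (Measure.pi fun _ : Fin k => densityMeasure g) (L := L.toReal * k) fun φ => by
      rw [← div_le_iff₀ hk']
      exact (ENNReal.ofReal_le_iff_le_toReal hL).1 (key φ)
  refine ENNReal.div_le_of_le_mul (h.trans (le_of_eq ?_))
  rw [ENNReal.ofReal_mul ENNReal.toReal_nonneg, ENNReal.ofReal_toReal hL, ENNReal.ofReal_natCast]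

/-- Asymptotic lower bound for the entropy of a one-particle limit. -/
theorem klDiv_le_liminf (hg : Measurable g) (hg0 : ∀ x, 0 ≤ g x)
    (h1 : ∫ x, g x = 1) (h2 : ∫ x, g x * x ^ 2 = 1) (h4 : Integrable fun x => g x * x ^ 4)
    (hp : ∃ p : ℝ≥0∞, 1 < p ∧ MemLp g p) {m : ∀ N : ℕ, ProbabilityMeasure (KacSphere N)}
    (hm : ∀ N, 0 < N → IsSymmetric (m N)) {μ : ProbabilityMeasure ℝ}
    (hlim : Tendsto (fun N => marginalOne (m N)) atTop (𝓝 μ)) :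
    klDiv (μ : Measure ℝ) (densityMeasure g) ≤
      liminf (fun N : ℕ => klDiv (m N : Measure (KacSphere N)) (condTensor g N) / N) atTop := by
  have hprob := isProbabilityMeasure_densityMeasure hg0 h1
  have hc : Continuous fun (t : ℝ) (_ : Fin 1) => t := by fun_prop
  have hback : ∀ N, (marginalOne (m N)).map hc.measurable.aemeasurable = marginal 1 (m N) :=
    fun N => by
      refine Subtype.ext ?_
      rw [ProbabilityMeasure.val_eq_to_measure, ProbabilityMeasure.val_eq_to_measure,
        ProbabilityMeasure.toMeasure_map, marginalOne, ProbabilityMeasure.toMeasure_map,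
        Measure.map_map hc.measurable (measurable_pi_apply _)]
      convert Measure.map_id
      ext y i
      simp [Subsingleton.elim i 0]
  have hlim' := ProbabilityMeasure.tendsto_map_of_tendsto_of_continuous _ _ hlim hc
  simp_rw [hback] at hlim'
  have h := klDiv_div_le_liminf hg hg0 h1 h2 h4 hp hm one_pos hlim'
  rw [Nat.cast_one, div_one] at h
  refine le_trans ?_ h
  -- The identification of ℝ with ℝ^1 cannot increase entropy, by the data-processing inequality for
  -- the coordinate map.
  have hdp := klDiv_map_le (μ := ((μ.map hc.measurable.aemeasurable : ProbabilityMeasure (Fin 1 → ℝ)) :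
      Measure (Fin 1 → ℝ))) (ν := Measure.pi fun _ : Fin 1 => densityMeasure g)
    (measurable_pi_apply (0 : Fin 1))
  rw [(measurePreserving_eval (fun _ : Fin 1 => densityMeasure g) 0).map_eq,
    ProbabilityMeasure.toMeasure_map, Measure.map_map (measurable_pi_apply _) hc.measurable] at hdp
  rwa [show (fun y : Fin 1 → ℝ => y 0) ∘ (fun (t : ℝ) (_ : Fin 1) => t) = id from rfl,
    Measure.map_id] at hdp

end EntropyPerParticle

/-! ### The Gaussian case -/

section Gaussian

theorem densityMeasure_gaussian : densityMeasure (gaussianPDFReal 0 1) = gaussianReal 0 1 := by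
  rw [gaussianReal_of_var_ne_zero 0 one_ne_zero]
  rfl

theorem integral_gaussianPDFReal_mul_sq : ∫ x, gaussianPDFReal 0 1 x * x ^ 2 = 1 := by
  rw [← integral_densityMeasure (measurable_gaussianPDFReal 0 1) (gaussianPDFReal_nonneg 0 1)
    (fun x => x ^ 2), densityMeasure_gaussian]
  have h := variance_fun_id_gaussianReal (μ := 0) (v := 1)
  rw [variance_eq_integral (by fun_prop), integral_id_gaussianReal] at h
  simpa using h

theorem integrable_gaussianPDFReal_mul_pow_four :
    Integrable fun x => gaussianPDFReal 0 1 x * x ^ 4 := by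
  rw [← integrable_densityMeasure_iff (measurable_gaussianPDFReal 0 1) (gaussianPDFReal_nonneg 0 1)
    (f := fun x => x ^ 4), densityMeasure_gaussian]
  have h := (memLp_id_gaussianReal (μ := 0) (v := 1) 4).integrable_norm_pow (p := 4) (by norm_num)
  refine h.congr (Eventually.of_forall fun x => ?_)
  simp only [id, Real.norm_eq_abs]
  exact Even.pow_abs (by decide) x

theorem memLp_top_gaussianPDFReal : MemLp (gaussianPDFReal 0 1) ∞ := by
  refine memLp_top_of_bound (measurable_gaussianPDFReal 0 1).aestronglyMeasurable
    ((Real.sqrt (2 * Real.pi * 1))⁻¹) (Eventually.of_forall fun x => ?_)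
  rw [Real.norm_of_nonneg (gaussianPDFReal_nonneg 0 1 x), gaussianPDFReal_def]
  refine mul_le_of_le_one_right (by positivity) (Real.exp_le_one_iff.2 ?_)
  rw [neg_div]
  exact neg_nonpos.2 (by positivity)

/-- On the sphere, the tensor power of the standard Gaussian density is constant, so the
conditioned tensor product is the uniform measure. -/
theorem condTensor_gaussian (n : ℕ) : condTensor (gaussianPDFReal 0 1) (n + 1) = unif (n + 1) := by
  set c : ℝ :=
    ((Real.sqrt (2 * Real.pi * 1))⁻¹) ^ (n + 1) * Real.exp (-((n + 1 : ℕ) : ℝ) / 2) with hc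
  have hc0 : 0 < c := by positivity
  have htd : tensorDensity (gaussianPDFReal 0 1) (n + 1) = fun _ => ENNReal.ofReal c := by
    ext v
    have hs := sqSum_coe v
    rw [tensorDensity, ← ENNReal.ofReal_prod_of_nonneg fun _ _ => gaussianPDFReal_nonneg 0 1 _]
    congr 1
    simp only [gaussianPDFReal_def]
    have he : ∑ j, -((v : EuclideanSpace ℝ (Fin (n + 1))) j - 0) ^ 2 / (2 * ((1 : NNReal) : ℝ)) =
        -((n + 1 : ℕ) : ℝ) / 2 := by
      have hs' : ∑ j, (v : EuclideanSpace ℝ (Fin (n + 1))) j ^ 2 = ((n + 1 : ℕ) : ℝ) := hs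
      simp only [sub_zero, NNReal.coe_one, mul_one]
      rw [← Finset.sum_div, Finset.sum_neg_distrib, hs']
    rw [Finset.prod_mul_distrib, ← Real.exp_sum, Finset.prod_const, he, hc]
    simp
  have h0 : ENNReal.ofReal c ≠ 0 := by simpa using hc0
  rw [condTensor, Z, htd, lintegral_const, measure_univ, mul_one, withDensity_const, smul_smul,
    ENNReal.inv_mul_cancel h0 ENNReal.ofReal_ne_top, one_smul]

end Gaussian

/-! ### Chaotic sequences and the final statement -/

theorem tendsto_marginalOne_of_isChaotic {μ : ProbabilityMeasure ℝ}
    {m : ∀ N : ℕ, ProbabilityMeasure (KacSphere N)} (h : IsChaotic μ m) :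
    Tendsto (fun N => marginalOne (m N)) atTop (𝓝 μ) := by
  have h1 := h.2 1 one_pos
  have hc : Continuous fun y : Fin 1 → ℝ => y 0 := continuous_apply 0
  have h2 := ProbabilityMeasure.tendsto_map_of_tendsto_of_continuous _ _ h1 hc
  have he : (tensorPower μ 1).map hc.measurable.aemeasurable = μ := by
    refine Subtype.ext ?_
    exact (measurePreserving_eval (fun _ : Fin 1 => (μ : Measure ℝ)) 0).map_eq
  rwa [he] at h2

end KacChaos

theorem mainTheorem5 :
    (∀ g : ℝ → ℝ, Measurable g → (∀ x, 0 ≤ g x) → ∫ x, g x = 1 →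
      ∫ x, g x * x ^ 2 = 1 → Integrable (fun x => g x * x ^ 4) →
      (∃ p : ℝ≥0∞, 1 < p ∧ MemLp g p) →
      (∀ᶠ N : ℕ in atTop, 0 < KacChaos.Z g N ∧ KacChaos.Z g N < ∞) ∧
      ∀ m : ∀ N : ℕ, ProbabilityMeasure (KacChaos.KacSphere N),
        (∀ N, 0 < N → KacChaos.IsSymmetric (m N)) →
        (∀ μ : ProbabilityMeasure ℝ,
          Tendsto (fun N => KacChaos.marginalOne (m N)) atTop (𝓝 μ) →
          klDiv (μ : Measure ℝ) (KacChaos.densityMeasure g) ≤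
            liminf (fun N : ℕ =>
              klDiv (m N : Measure (KacChaos.KacSphere N)) (KacChaos.condTensor g N) / N)
              atTop) ∧
        (∀ k : ℕ, 0 < k → ∀ μk : ProbabilityMeasure (Fin k → ℝ),
          Tendsto (fun N => KacChaos.marginal k (m N)) atTop (𝓝 μk) →
          klDiv (μk : Measure (Fin k → ℝ))
              (Measure.pi fun _ : Fin k => KacChaos.densityMeasure g) / k ≤
            liminf (fun N : ℕ =>
              klDiv (m N : Measure (KacChaos.KacSphere N)) (KacChaos.condTensor g N) / N)
              atTop)) ∧
    (∀ (μ : ProbabilityMeasure ℝ) (m : ∀ N : ℕ, ProbabilityMeasure (KacChaos.KacSphere N)),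
      KacChaos.IsChaotic μ m →
      klDiv (μ : Measure ℝ) (gaussianReal 0 1) ≤
        liminf (fun N : ℕ =>
          klDiv (m N : Measure (KacChaos.KacSphere N)) (KacChaos.unif N) / N) atTop) := by
  refine ⟨fun g hg hg0 h1 h2 h4 hp => ⟨?_, fun m hm => ⟨fun μ hμ => ?_, fun k hk μk hμk => ?_⟩⟩,
    fun μ m hm => ?_⟩
  · obtain ⟨m₀, B, hB⟩ := KacChaos.eventually_le_klDiv hg hg0 h1 h2 h4 hp
    exact (hB 1 one_pos).mono fun N hN => hN.1
  · exact KacChaos.klDiv_le_liminf hg hg0 h1 h2 h4 hp hm hμ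
  · exact KacChaos.klDiv_div_le_liminf hg hg0 h1 h2 h4 hp hm hk hμk
  · have h := KacChaos.klDiv_le_liminf (measurable_gaussianPDFReal 0 1)
      (gaussianPDFReal_nonneg 0 1) (integral_gaussianPDFReal_eq_one 0 one_ne_zero)
      KacChaos.integral_gaussianPDFReal_mul_sq KacChaos.integrable_gaussianPDFReal_mul_pow_four
      ⟨∞, ENNReal.one_lt_top, KacChaos.memLp_top_gaussianPDFReal⟩ hm.1
      (KacChaos.tendsto_marginalOne_of_isChaotic hm)
    rw [KacChaos.densityMeasure_gaussian] at h
    -- The conditioned Gaussian product is σ^N only for N ≥ 1, which is enough for a liminf.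
    refine h.trans (le_of_eq (liminf_congr ?_))
    filter_upwards [eventually_gt_atTop 0] with N hN
    obtain ⟨n, rfl⟩ : ∃ n, N = n + 1 := ⟨N - 1, by omega⟩
    rw [KacChaos.condTensor_gaussian]
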